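/- Let $d\ge 2$, let $\Omega\subset\mathbb{R}^d$ be a bounded convex domain with $C^2$ boundary and unit outward normal $n$, and let $\mathbf{v}=(v_1,\dots,v_d)\in C^2(\overline{\Omega},\mathbb{R}^d)$ satisfy $\mathbf{v}\cdot n=0$ on $\partial\Omega$. Set $g=|\mathbf{v}|^2$ and $\operatorname{div}\mathbf{v}=\sum_i \frac{\partial v_i}{\partial x_i}$, write $\{g=t\}=\{x\in\Omega: g(x)=t\}$ and $\{g>t\}=\{x\in\Omega: g(x)>t\}$, and let $\sigma=H^{d-1}$ be the $(d-1)$-dimensional Hausdorff measure, normalized to agree with the usual surface area. Then for a.e. $t\in(0,\infty)$ all the integrals below converge absolutely and $$ \int_{\{g=t\}}|\nabla g|\,d\sigma\;\le\; 2\sqrt t\int_{\{g=t\}}\Big\{\Big(\sum_{i,j=1}^d\Big|\frac{\partial v_i}{\partial x_j}-\frac{\partial v_j}{\partial x_i}\Big|^2\Big)^{1/2}+|\operatorname{div}\mathbf{v}|\Big\}\,d\sigma +2\int_{\{g>t\}}\Big\{|\operatorname{div}\mathbf{v}|^2-\sum_{i,j=1}^d\frac{\partial v_i}{\partial x_j}\frac{\partial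 v_j}{\partial x_i}\Big\}\,dx . $$ -/

import Mathlib

open scoped MeasureTheory

/-- `ρ` is a `C²` defining function of `Ω` on the open neighbourhood `U` of `p`:
inside `U`, the set `Ω` is exactly where `ρ` is negative, and `∇ρ(p) ≠ 0`. -/
structure IsC2DefiningFunction {d : ℕ} (Ω : Set (EuclideanSpace ℝ (Fin d)))
    (p : EuclideanSpace ℝ (Fin d)) (U : Set (EuclideanSpace ℝ (Fin d)))
    (ρ : EuclideanSpace ℝ (Fin d) → ℝ) : Prop where
  isOpen : IsOpen U
  mem : p ∈ U
  contDiffOn : ContDiffOn ℝ 2 ρ U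
  inter_eq : Ω ∩ U = {x ∈ U | ρ x < 0}
  gradient_ne_zero : gradient ρ p ≠ 0

/-- `Ω` has `C²` boundary: near each boundary point it has a `C²` defining function
(equivalently, by the implicit function theorem, `Ω` is locally the region on one side
of the graph of a `C²` function, in suitable orthonormal coordinates). -/
def HasC2Boundary {d : ℕ} (Ω : Set (EuclideanSpace ℝ (Fin d))) : Prop :=
  ∀ p ∈ frontier Ω, ∃ U ρ, IsC2DefiningFunction Ω p U ρ

/-- `n` is the unit outward normal to `Ω` at the boundary point `p`, that is
`n = ∇ρ(p) / |∇ρ(p)|` for a local defining function `ρ` (negative inside `Ω`). -/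
def IsUnitOutwardNormal {d : ℕ} (Ω : Set (EuclideanSpace ℝ (Fin d)))
    (p n : EuclideanSpace ℝ (Fin d)) : Prop :=
  ∃ U ρ, IsC2DefiningFunction Ω p U ρ ∧ n = ‖gradient ρ p‖⁻¹ • gradient ρ p

/-- The partial derivative `∂vᵢ/∂xⱼ` at `x`. -/
noncomputable def partialD {d : ℕ} (v : EuclideanSpace ℝ (Fin d) → EuclideanSpace ℝ (Fin d))
    (i j : Fin d) (x : EuclideanSpace ℝ (Fin d)) : ℝ :=
  fderiv ℝ (fun y => v y i) x (EuclideanSpace.single j 1)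

/-- The divergence `∑ᵢ ∂vᵢ/∂xᵢ`. -/
noncomputable def divergence {d : ℕ} (v : EuclideanSpace ℝ (Fin d) → EuclideanSpace ℝ (Fin d))
    (x : EuclideanSpace ℝ (Fin d)) : ℝ :=
  ∑ i, partialD v i i x

/-- The size of the curl, `(∑ᵢⱼ |∂vᵢ/∂xⱼ - ∂vⱼ/∂xᵢ|²)^{1/2}`. -/
noncomputable def curlNorm {d : ℕ} (v : EuclideanSpace ℝ (Fin d) → EuclideanSpace ℝ (Fin d))
    (x : EuclideanSpace ℝ (Fin d)) : ℝ :=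
  √(∑ i, ∑ j, |partialD v i j x - partialD v j i x| ^ 2)

/-!
Let `w = Dv v - (div v) v` and `q = |div v|² - ∑ᵢⱼ ∂ⱼvᵢ ∂ᵢvⱼ`. The second derivatives of `v` cancel
in `div w = -q`. Since `v` is tangent to the boundary, the outward normal component of `w` is minus
the second fundamental form of the boundary at `v`, hence nonpositive by convexity. Therefore
`∫ div (Φ(g) w) ≤ 0` whenever `Φ` is the primitive vanishing at `0` of some `ψ ≥ 0`, that is,
`∫ ψ(g) w · ∇g ≤ ∫ Φ(g) q`. Since `∇g = 2 (Dv)ᵀ v`, and `(Dv)ᵀ v - Dv v` is controlled by the curl,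
`|∇g|² - 2 √g (|curl v| + |div v|) |∇g| ≤ 2 w · ∇g`, so that
`∫ ψ(g) |∇g|² ≤ ∫ ψ(g) 2 √g (|curl v| + |div v|) |∇g| + 2 ∫ Φ(g) q`.
The coarea formula and the layer cake formula turn this into the asserted inequality integrated
against `ψ`, and `ψ` is arbitrary. Sard's theorem would require `g` to be `d` times differentiable,
so the critical levels are handled by Eilenberg's inequality instead.
-/

section

open MeasureTheory Module Set Filter Topology
open scoped ENNReal NNReal RealInnerProductSpace

local notation "𝔼" d:max => EuclideanSpace ℝ (Fin d)

section Coarea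

open Measure

section EMetric

variable {X Y : Type*} [EMetricSpace X] [EMetricSpace Y] {K : ℝ≥0} {F : X → Y} {s t : Set X}

/-- `F` is bi-Lipschitz on `s` with constant `K`: it distorts the distances between points of `s`
by a factor of at most `K` in either direction. -/
structure BiLipschitzOn (K : ℝ≥0) (F : X → Y) (s : Set X) : Prop where
  lipschitzOnWith : LipschitzOnWith K F s
  antilipschitzWith : AntilipschitzWith K (s.domRestrict F)

namespace BiLipschitzOn

theorem mono (h : BiLipschitzOn K F t) (hst : s ⊆ t) : BiLipschitzOn K F s where
  lipschitzOnWith := h.lipschitzOnWith.mono hst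
  antilipschitzWith x y := h.antilipschitzWith (inclusion hst x) (inclusion hst y)

theorem injOn (h : BiLipschitzOn K F s) : InjOn F s :=
  injOn_iff_injective.2 h.antilipschitzWith.injective

variable [MeasurableSpace X] [BorelSpace X] [MeasurableSpace Y] [BorelSpace Y]

theorem euclideanHausdorffMeasure_image_le (h : BiLipschitzOn K F s) (k : ℕ) :
    μHE[k] (F '' s) ≤ (K : ℝ≥0∞) ^ k * μHE[k] s := by
  simp_rw [euclideanHausdorffMeasure_def, Measure.smul_apply, mul_smul_comm]
  gcongr
  simpa using h.lipschitzOnWith.hausdorffMeasure_image_le (Nat.cast_nonneg k)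

theorem euclideanHausdorffMeasure_le_image (h : BiLipschitzOn K F s) (k : ℕ) :
    μHE[k] s ≤ (K : ℝ≥0∞) ^ k * μHE[k] (F '' s) := by
  simp_rw [euclideanHausdorffMeasure_def, Measure.smul_apply, mul_smul_comm]
  gcongr
  have := h.antilipschitzWith.le_hausdorffMeasure_image (Nat.cast_nonneg k) univ
  rwa [image_univ, range_domRestrict, ← isometry_subtype_coe.hausdorffMeasure_image (by simp),
    image_univ, Subtype.range_coe, ENNReal.rpow_natCast] at this

end BiLipschitzOn

end EMetric

theorem exists_nhds_biLipschitzOn {E : Type*} [NormedAddCommGroup E] [NormedSpace ℝ E] {F : E → E}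
    {x₀ : E} (hF : HasStrictFDerivAt F (ContinuousLinearMap.id ℝ E) x₀) {K : ℝ≥0} (hK : 1 < K) :
    ∃ U ∈ 𝓝 x₀, BiLipschitzOn K F U := by
  have hc : 0 < 1 - K⁻¹ := tsub_pos_of_lt (inv_lt_one_of_one_lt₀ hK)
  obtain ⟨U, hU, hFU⟩ := hF.approximates_deriv_on_nhds (Or.inr hc)
  have hsub : LipschitzOnWith (1 - K⁻¹) (F - id) U := hFU.lipschitzOnWith
  have hcK : 1 - K⁻¹ < 1 := tsub_lt_self one_pos (inv_pos.2 (one_pos.trans hK))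
  refine ⟨U, hU, ?_, ?_⟩
  · have h1 : 1 + (1 - K⁻¹) ≤ K := by
      rw [← NNReal.coe_le_coe, NNReal.coe_add, NNReal.coe_sub (inv_le_one_of_one_le₀ hK.le)]
      have hK₀ : (0 : ℝ) < K := one_pos.trans hK
      have := (Real.one_sub_inv_le_log_of_pos hK₀).trans (Real.log_le_sub_one_of_pos hK₀)
      push_cast
      linarith
    simpa using (LipschitzWith.id.lipschitzOnWith.add hsub).weaken h1
  · have := (AntilipschitzWith.subtype_coe U).add_sub_lipschitzWith (g := U.domRestrict F)
      (Kg := 1 - K⁻¹) (lipschitzOnWith_iff_restrict.1 hsub) (by simpa using hcK)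
    rwa [inv_one, tsub_tsub_cancel_of_le (inv_le_one_of_one_le₀ hK.le), inv_inv] at this

section InnerProductSpace

variable {V : Type*} [NormedAddCommGroup V] [InnerProductSpace ℝ V]

theorem setOf_inner_eq_eq_range {e : V} (he : ‖e‖ = 1) (s : ℝ) :
    {z | ⟪e, z⟫ = s} = range fun w : (ℝ ∙ e)ᗮ => s • e + (w : V) := by
  ext z
  constructor
  · intro hz
    refine ⟨⟨z - s • e, ?_⟩, by simp⟩
    rw [Submodule.mem_orthogonal_singleton_iff_inner_right, inner_sub_right, inner_smul_right,
      real_inner_self_eq_norm_sq, he, hz.out]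
    simp
  · rintro ⟨w, rfl⟩
    have := Submodule.mem_orthogonal_singleton_iff_inner_right.1 w.2
    simp [inner_add_right, inner_smul_right, he, this]

variable [FiniteDimensional ℝ V] [MeasurableSpace V] [BorelSpace V]

theorem measurable_euclideanHausdorffMeasure_inter_slice {e : V} (he : ‖e‖ = 1) {B : Set V}
    (hB : MeasurableSet B) :
    Measurable fun s : ℝ => μHE[finrank ℝ V - 1] (B ∩ {z | ⟪e, z⟫ = s}) := by
  have hrank : finrank ℝ V - 1 = finrank ℝ (ℝ ∙ e)ᗮ := by
    have := (ℝ ∙ e).finrank_add_finrank_orthogonal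
    rw [finrank_span_singleton (norm_ne_zero_iff.1 (he ▸ one_ne_zero))] at this
    omega
  have hiso (s : ℝ) : Isometry fun w : (ℝ ∙ e)ᗮ => s • e + (w : V) :=
    (IsometryEquiv.addLeft (s • e)).isometry.comp isometry_subtype_coe
  simp_rw [setOf_inner_eq_eq_range he, ← image_preimage_eq_inter_range,
    (hiso _).euclideanHausdorffMeasure_image, hrank,
    InnerProductSpace.euclideanHausdorffMeasure_eq_volume]
  exact measurable_measure_prodMk_left
    (((measurable_fst.smul_const e).add measurable_snd.subtype_val) hB)

theorem lintegral_euclideanHausdorffMeasure_inter_slice {e : V} (he : ‖e‖ = 1) {B : Set V}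
    (hB : MeasurableSet B) :
    ∫⁻ s : ℝ, μHE[finrank ℝ V - 1] (B ∩ {z | ⟪e, z⟫ = s}) = volume B := by
  rw [← InnerProductSpace.euclideanHausdorffMeasure_eq_volume (V := V),
    EuclideanGeometry.euclideanHausdorffMeasure_eq_lintegral 0
      (norm_ne_zero_iff.1 (he ▸ one_ne_zero)) hB, ← ofReal_norm, he, ENNReal.ofReal_one, one_mul]
  refine lintegral_congr fun s => congrArg _ (congrArg _ ?_)
  ext z
  simp [Submodule.mem_orthogonal_singleton_iff_inner_right, inner_sub_right, inner_smul_right, he,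
    sub_eq_zero]

end InnerProductSpace

section CoareaFormula

variable {V : Type*} [NormedAddCommGroup V] [InnerProductSpace ℝ V]

/-- The map that changes `x` along the unit vector `e` so that its `e`-coordinate becomes
`g x / a`; it carries the level sets of `g` into hyperplanes orthogonal to `e`. -/
noncomputable def straightening (g : V → ℝ) (a : ℝ) (e x : V) : V :=
  x + (g x / a - ⟪e, x⟫) • e

theorem inner_straightening {e : V} (he : ‖e‖ = 1) (g : V → ℝ) (a : ℝ) (x : V) :
    ⟪e, straightening g a e x⟫ = g x / a := by
  simp [straightening, inner_add_right, inner_smul_right, he]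

theorem hasStrictFDerivAt_straightening {g : V → ℝ} {a : ℝ} (ha : a ≠ 0) {e x₀ : V}
    (hg : HasStrictFDerivAt g (a • innerSL ℝ e) x₀) :
    HasStrictFDerivAt (straightening g a e) (ContinuousLinearMap.id ℝ V) x₀ := by
  have h := (hasStrictFDerivAt_id x₀).add
    (((hg.mul_const a⁻¹).sub (innerSL ℝ e).hasStrictFDerivAt).smul_const e)
  convert! h using 1
  simp [smul_smul, ha]

theorem image_inter_level {F : V → V} {A : Set V} {g : V → ℝ} {a : ℝ} (ha : a ≠ 0) {e : V}
    (hFg : ∀ x ∈ A, ⟪e, F x⟫ = g x / a) (t : ℝ) :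
    F '' (A ∩ {x | g x = t}) = F '' A ∩ {z | ⟪e, z⟫ = t / a} := by
  rw [← image_inter_preimage]
  congr 1
  ext x
  refine and_congr_right fun hx => ?_
  simp [hFg x hx, div_left_inj' ha]

theorem enorm_gradient_eq_enorm_fderiv [CompleteSpace V] (g : V → ℝ) (x : V) :
    ‖gradient g x‖ₑ = ‖fderiv ℝ g x‖ₑ := by
  simp [gradient, ← ofReal_norm]

section FiniteDimensional

variable [FiniteDimensional ℝ V] [MeasurableSpace V] [BorelSpace V] {g : V → ℝ} {A : Set V}

/-- The coarea formula for `g` on `A` up to the factor `C`: the measures of the slices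
`A ∩ {g = t}` are comparable to a measurable function of `t` whose integral is comparable to
`∫_A |∇g|`. Measurability of the slice measure itself is only known once `C` can be taken
arbitrarily close to `1`. -/
def CoareaComparable (g : V → ℝ) (C : ℝ≥0∞) (A : Set V) : Prop :=
  ∃ h : ℝ → ℝ≥0∞, Measurable h ∧
    (∀ t, μHE[finrank ℝ V - 1] (A ∩ {x | g x = t}) ≤ C * h t) ∧
    (∀ t, h t ≤ C * μHE[finrank ℝ V - 1] (A ∩ {x | g x = t})) ∧
    ∫⁻ t, h t ≤ C * ∫⁻ x in A, ‖gradient g x‖ₑ ∧ ∫⁻ x in A, ‖gradient g x‖ₑ ≤ C * ∫⁻ t, h t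

theorem CoareaComparable.iUnion {C : ℝ≥0∞} {A : ℕ → Set V} (hA : ∀ n, CoareaComparable g C (A n))
    (hm : ∀ n, MeasurableSet (A n)) (hd : Pairwise (Function.onFun Disjoint A))
    (hl : ∀ n t, MeasurableSet (A n ∩ {x | g x = t})) :
    CoareaComparable g C (⋃ n, A n) := by
  choose h hmeas hslice_le hle_slice hint_le hle_int using hA
  have hslice (t : ℝ) : μHE[finrank ℝ V - 1] ((⋃ n, A n) ∩ {x | g x = t}) =
      ∑' n, μHE[finrank ℝ V - 1] (A n ∩ {x | g x = t}) := by
    rw [iUnion_inter, measure_iUnion _ fun n => hl n t]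
    exact fun i j hij => (hd hij).mono inter_subset_left inter_subset_left
  refine ⟨fun t => ∑' n, h n t, Measurable.tsum hmeas, fun t => ?_, fun t => ?_, ?_, ?_⟩
  · rw [hslice, ← ENNReal.tsum_mul_left]
    exact ENNReal.tsum_le_tsum fun n => hslice_le n t
  · rw [hslice, ← ENNReal.tsum_mul_left]
    exact ENNReal.tsum_le_tsum fun n => hle_slice n t
  · rw [lintegral_tsum fun n => (hmeas n).aemeasurable, lintegral_iUnion hm hd,
      ← ENNReal.tsum_mul_left]
    exact ENNReal.tsum_le_tsum hint_le
  · rw [lintegral_tsum fun n => (hmeas n).aemeasurable, lintegral_iUnion hm hd,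
      ← ENNReal.tsum_mul_left]
    exact ENNReal.tsum_le_tsum hle_int

theorem lintegral_comp_div {a : ℝ≥0} (ha : a ≠ 0) (h : ℝ → ℝ≥0∞) :
    ∫⁻ t, h (t / a) = a * ∫⁻ s, h s := by
  have ha' : (a : ℝ)⁻¹ ≠ 0 := inv_ne_zero (NNReal.coe_ne_zero.2 ha)
  simp_rw [div_eq_mul_inv]
  have hmul : MeasurableEmbedding fun t : ℝ => t * (a : ℝ)⁻¹ :=
    (Homeomorph.mulRight₀ _ ha').measurableEmbedding
  rw [← hmul.lintegral_map h, Real.map_volume_mul_right ha', lintegral_smul_measure, inv_inv,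
    NNReal.abs_eq, ENNReal.ofReal_coe_nnreal, smul_eq_mul]

variable {F : V → V} {e : V} {a K : ℝ≥0}

theorem BiLipschitzOn.setLIntegral_enorm_gradient_le (hF : BiLipschitzOn K F A)
    (hA : MeasurableSet A) (hle : ∀ x ∈ A, ‖gradient g x‖₊ ≤ K * a) :
    ∫⁻ x in A, ‖gradient g x‖ₑ ≤ K ^ (finrank ℝ V + 1) * (a * volume (F '' A)) := by
  have hvol := hF.euclideanHausdorffMeasure_le_image (finrank ℝ V)
  rw [InnerProductSpace.euclideanHausdorffMeasure_eq_volume] at hvol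
  calc ∫⁻ x in A, ‖gradient g x‖ₑ ≤ ∫⁻ _ in A, (K * a : ℝ≥0) :=
        setLIntegral_mono' hA fun x hx => ENNReal.coe_le_coe.2 (hle x hx)
    _ = K * a * volume A := by rw [setLIntegral_const, ENNReal.coe_mul]
    _ ≤ K * a * (K ^ finrank ℝ V * volume (F '' A)) := by gcongr
    _ = K ^ (finrank ℝ V + 1) * (a * volume (F '' A)) := by ring

theorem BiLipschitzOn.mul_volume_image_le (hF : BiLipschitzOn K F A) (hA : MeasurableSet A)
    (hle : ∀ x ∈ A, a ≤ K * ‖gradient g x‖₊) :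
    a * volume (F '' A) ≤ K ^ (finrank ℝ V + 1) * ∫⁻ x in A, ‖gradient g x‖ₑ := by
  have hvol := hF.euclideanHausdorffMeasure_image_le (finrank ℝ V)
  rw [InnerProductSpace.euclideanHausdorffMeasure_eq_volume] at hvol
  calc a * volume (F '' A) ≤ a * (K ^ finrank ℝ V * volume A) := by gcongr
    _ = K ^ finrank ℝ V * ∫⁻ _ in A, a := by rw [setLIntegral_const]; ring
    _ ≤ K ^ finrank ℝ V * ∫⁻ x in A, K * ‖gradient g x‖ₑ := by
        refine mul_le_mul_right (setLIntegral_mono' hA fun x hx => ?_) _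
        simpa [enorm_eq_nnnorm] using ENNReal.coe_le_coe.2 (hle x hx)
    _ = K ^ (finrank ℝ V + 1) * ∫⁻ x in A, ‖gradient g x‖ₑ := by
        rw [lintegral_const_mul' _ _ ENNReal.coe_ne_top]; ring

theorem coareaComparable_of_biLipschitzOn (hF : BiLipschitzOn K F A) (hK : 1 ≤ K)
    (hA : MeasurableSet A) (he : ‖e‖ = 1) (ha : a ≠ 0) (hFg : ∀ x ∈ A, ⟪e, F x⟫ = g x / a)
    (hle : ∀ x ∈ A, a ≤ K * ‖gradient g x‖₊ ∧ ‖gradient g x‖₊ ≤ K * a) :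
    CoareaComparable g (K ^ (finrank ℝ V + 1)) A := by
  have hFA : MeasurableSet (F '' A) :=
    hA.image_of_continuousOn_injOn hF.lipschitzOnWith.continuousOn hF.injOn
  have hpow : (K : ℝ≥0∞) ^ (finrank ℝ V - 1) ≤ K ^ (finrank ℝ V + 1) :=
    pow_le_pow_right₀ (mod_cast hK) (by omega)
  set h : ℝ → ℝ≥0∞ := fun s => μHE[finrank ℝ V - 1] (F '' A ∩ {z | ⟪e, z⟫ = s})
  have hslice (t : ℝ) : h (t / a) = μHE[finrank ℝ V - 1] (F '' (A ∩ {x | g x = t})) :=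
    congrArg μHE[finrank ℝ V - 1] (image_inter_level (NNReal.coe_ne_zero.2 ha) hFg t).symm
  have hint : ∫⁻ t, h (t / a) = a * volume (F '' A) := by
    rw [lintegral_comp_div ha h, lintegral_euclideanHausdorffMeasure_inter_slice he hFA]
  refine ⟨fun t => h (t / a),
    (measurable_euclideanHausdorffMeasure_inter_slice he hFA).comp (measurable_id.div_const _),
    fun t => ?_, fun t => ?_, ?_, ?_⟩
  · simp only [hslice]
    grw [(hF.mono inter_subset_left).euclideanHausdorffMeasure_le_image, hpow]
  · simp only [hslice]
    grw [(hF.mono inter_subset_left).euclideanHausdorffMeasure_image_le, hpow]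
  · rw [hint]
    exact hF.mul_volume_image_le hA fun x hx => (hle x hx).1
  · rw [hint]
    exact hF.setLIntegral_enorm_gradient_le hA fun x hx => (hle x hx).2

theorem eventually_nnnorm_comparable {X E : Type*} [TopologicalSpace X] [NormedAddCommGroup E]
    {f : X → E} {x₀ : X} (hf : ContinuousAt f x₀) (h0 : f x₀ ≠ 0) {K : ℝ≥0} (hK : 1 < K) :
    ∀ᶠ x in 𝓝 x₀, ‖f x₀‖₊ ≤ K * ‖f x‖₊ ∧ ‖f x‖₊ ≤ K * ‖f x₀‖₊ := by
  have hlt : ‖f x₀‖₊ < K * ‖f x₀‖₊ := lt_mul_of_one_lt_left (nnnorm_pos.2 h0) hK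
  filter_upwards [(hf.nnnorm.const_mul K).eventually_const_lt hlt,
    hf.nnnorm.eventually_lt_const hlt] with x h1 h2 using ⟨h1.le, h2.le⟩

theorem exists_nhds_coareaComparable {x₀ : V} (hg : ContDiffAt ℝ 1 g x₀) (h0 : gradient g x₀ ≠ 0)
    {K : ℝ≥0} (hK : 1 < K) :
    ∃ U ∈ 𝓝 x₀, ∀ A ⊆ U, MeasurableSet A → CoareaComparable g (K ^ (finrank ℝ V + 1)) A := by
  set a : ℝ≥0 := ‖gradient g x₀‖₊
  set e : V := (a : ℝ)⁻¹ • gradient g x₀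
  have ha : a ≠ 0 := nnnorm_ne_zero_iff.2 h0
  have he : ‖e‖ = 1 := norm_smul_inv_norm h0
  have hga : fderiv ℝ g x₀ = (a : ℝ) • innerSL ℝ e := by
    ext y
    simp [e, gradient, NNReal.coe_ne_zero.2 ha]
  have hF := hasStrictFDerivAt_straightening (NNReal.coe_ne_zero.2 ha)
    (hga ▸ hg.hasStrictFDerivAt one_ne_zero)
  have hcont : ContinuousAt (gradient g) x₀ :=
    (InnerProductSpace.toDual ℝ V).symm.continuous.continuousAt.comp
      (hg.fderiv_right (m := 0) le_rfl).continuousAt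
  obtain ⟨U, hU, hFU⟩ := exists_nhds_biLipschitzOn hF hK
  refine ⟨_, inter_mem hU (eventually_nnnorm_comparable hcont h0 hK), fun A hAU hA => ?_⟩
  exact coareaComparable_of_biLipschitzOn (hFU.mono fun x hx => (hAU hx).1) hK.le hA he ha
    (fun x _ => inner_straightening he g a x) fun x hx => (hAU hx).2

end FiniteDimensional

theorem exists_measurable_partition_of_locally {X : Type*} [TopologicalSpace X]
    [SecondCountableTopology X] [MeasurableSpace X] [OpensMeasurableSpace X] {A : Set X}
    {P : Set X → Prop} (hempty : P ∅) (hmono : ∀ ⦃s t⦄, s ⊆ t → P t → P s)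
    (hloc : ∀ x ∈ A, ∃ U ∈ 𝓝 x, P U) :
    ∃ D : ℕ → Set X, (∀ n, MeasurableSet (D n)) ∧ Pairwise (Function.onFun Disjoint D) ∧
      A ⊆ ⋃ n, D n ∧ ∀ n, P (D n) := by
  choose! U hU hPU using hloc
  obtain ⟨T, hTA, hTc, hT⟩ := TopologicalSpace.countable_cover_nhdsWithin
    fun x hx => mem_nhdsWithin_of_mem_nhds (interior_mem_nhds.2 (hU x hx))
  obtain ⟨u, hu⟩ := ((hTc.image fun x => interior (U x)).insert ∅).exists_eq_range
    (insert_nonempty _ _)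
  have hu' (n : ℕ) : IsOpen (u n) ∧ P (u n) := by
    have hn : u n ∈ range u := mem_range_self n
    rw [← hu] at hn
    rcases hn with hn | ⟨x, hx, hn⟩
    · exact hn ▸ ⟨isOpen_empty, hempty⟩
    · exact hn ▸ ⟨isOpen_interior, hmono interior_subset (hPU x (hTA hx))⟩
  refine ⟨disjointed u, fun n => MeasurableSet.disjointed (fun n => (hu' n).1.measurableSet) n,
    disjoint_disjointed u, ?_, fun n => hmono (disjointed_subset u n) (hu' n).2⟩
  rw [iUnion_disjointed, ← sUnion_range, ← hu, sUnion_insert, empty_union, sUnion_image]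
  exact hT

variable {V : Type*} [NormedAddCommGroup V] [InnerProductSpace ℝ V]
  [FiniteDimensional ℝ V] [MeasurableSpace V] [BorelSpace V] {g : V → ℝ} {A : Set V}

theorem measurableSet_inter_level {X Y : Type*} [TopologicalSpace X] [MeasurableSpace X]
    [OpensMeasurableSpace X] [TopologicalSpace Y] [T1Space Y] {f : X → Y} {s : Set X}
    (hf : ContinuousOn f s) (hs : MeasurableSet s) (y : Y) : MeasurableSet (s ∩ {x | f x = y}) := by
  obtain ⟨u, hu, hus⟩ := continuousOn_iff_isClosed.1 hf {y} isClosed_singleton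
  have : s ∩ {x | f x = y} = u ∩ s := by rw [← hus, inter_comm]; rfl
  exact this ▸ hu.measurableSet.inter hs

theorem coareaComparable_of_contDiffAt (hg : ∀ x ∈ A, ContDiffAt ℝ 1 g x)
    (h0 : ∀ x ∈ A, gradient g x ≠ 0) (hA : MeasurableSet A) {K : ℝ≥0} (hK : 1 < K) :
    CoareaComparable g (K ^ (finrank ℝ V + 1)) A := by
  obtain ⟨D, hDm, hDd, hAD, hD⟩ := exists_measurable_partition_of_locally (A := A)
    (P := fun U => ∀ B ⊆ U, MeasurableSet B → CoareaComparable g (K ^ (finrank ℝ V + 1)) B)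
    (fun B hB _ => subset_empty_iff.1 hB ▸ ⟨0, measurable_zero, by simp, by simp, by simp, by simp⟩)
    (fun s t hst ht B hB => ht B (hB.trans hst))
    (fun x hx => exists_nhds_coareaComparable (hg x hx) (h0 x hx) hK)
  rw [← inter_eq_left.2 hAD, inter_iUnion]
  refine .iUnion (fun n => hD n _ inter_subset_right (hA.inter (hDm n)))
    (fun n => hA.inter (hDm n))
    (fun i j hij => (hDd hij).mono inter_subset_right inter_subset_right)
    fun n => measurableSet_inter_level (fun x hx => ?_) (hA.inter (hDm n))
  exact (hg x hx.1).continuousAt.continuousWithinAt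

theorem tendsto_coe_pow_mul_nhdsGT_one (k : ℕ) (b : ℝ≥0∞) :
    Tendsto (fun K : ℝ≥0 => (K : ℝ≥0∞) ^ k * b) (𝓝[>] 1) (𝓝 b) := by
  have h : Continuous fun K : ℝ≥0 => (K : ℝ≥0∞) ^ k := by fun_prop
  simpa using ENNReal.Tendsto.mul_const (b := b) ((h.tendsto 1).mono_left nhdsWithin_le_nhds)
    (Or.inl (by simp))

theorem le_of_forall_one_lt_pow_mul_le {k : ℕ} {a b : ℝ≥0∞}
    (h : ∀ K : ℝ≥0, 1 < K → a ≤ (K : ℝ≥0∞) ^ k * b) : a ≤ b :=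
  ge_of_tendsto (tendsto_coe_pow_mul_nhdsGT_one k b) <|
    eventually_mem_nhdsWithin.mono fun K hK => h K hK

theorem measurable_of_forall_exists_measurable_comparable {X : Type*} [MeasurableSpace X]
    {f : X → ℝ≥0∞} {k : ℕ} (h : ∀ K : ℝ≥0, 1 < K → ∃ u : X → ℝ≥0∞, Measurable u ∧
      (∀ x, f x ≤ K ^ k * u x) ∧ ∀ x, u x ≤ K ^ k * f x) : Measurable f := by
  choose! u hu hfu huf using h
  obtain ⟨K, -, hK1, hK⟩ := exists_seq_strictAnti_tendsto (1 : ℝ≥0)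
  have hK' : Tendsto K atTop (𝓝[>] 1) :=
    tendsto_nhdsWithin_iff.2 ⟨hK, .of_forall hK1⟩
  refine measurable_of_tendsto_metrizable
    (f := fun n x => (K n : ℝ≥0∞) ^ k * u (K n) x) (fun n => (hu _ (hK1 n)).const_mul _) ?_
  refine tendsto_pi_nhds.2 fun x => tendsto_of_tendsto_of_tendsto_of_le_of_le tendsto_const_nhds
    ((tendsto_coe_pow_mul_nhdsGT_one (k + k) (f x)).comp hK') (fun n => hfu _ (hK1 n) x) fun n => ?_
  calc (K n : ℝ≥0∞) ^ k * u (K n) x ≤ K n ^ k * (K n ^ k * f x) := by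
        gcongr
        exact huf _ (hK1 n) x
    _ = (K n : ℝ≥0∞) ^ (k + k) * f x := by ring

theorem measurable_euclideanHausdorffMeasure_inter_level (hg : ∀ x ∈ A, ContDiffAt ℝ 1 g x)
    (h0 : ∀ x ∈ A, gradient g x ≠ 0) (hA : MeasurableSet A) :
    Measurable fun t => μHE[finrank ℝ V - 1] (A ∩ {x | g x = t}) := by
  refine measurable_of_forall_exists_measurable_comparable (k := finrank ℝ V + 1) fun K hK => ?_
  obtain ⟨h, hm, h1, h2, -⟩ := coareaComparable_of_contDiffAt hg h0 hA hK
  exact ⟨h, hm, h1, h2⟩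

theorem lintegral_euclideanHausdorffMeasure_inter_level (hg : ∀ x ∈ A, ContDiffAt ℝ 1 g x)
    (h0 : ∀ x ∈ A, gradient g x ≠ 0) (hA : MeasurableSet A) :
    ∫⁻ t, μHE[finrank ℝ V - 1] (A ∩ {x | g x = t}) = ∫⁻ x in A, ‖gradient g x‖ₑ := by
  set k := finrank ℝ V + 1
  have hmeas := measurable_euclideanHausdorffMeasure_inter_level hg h0 hA
  apply le_antisymm <;> refine le_of_forall_one_lt_pow_mul_le (k := k + k) fun K hK => ?_ <;>
    obtain ⟨h, hm, hslice_le, hle_slice, hint_le, hle_int⟩ :=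
      coareaComparable_of_contDiffAt hg h0 hA hK
  · calc ∫⁻ t, μHE[finrank ℝ V - 1] (A ∩ {x | g x = t}) ≤ ∫⁻ t, K ^ k * h t :=
          lintegral_mono hslice_le
      _ = K ^ k * ∫⁻ t, h t := lintegral_const_mul _ hm
      _ ≤ K ^ k * (K ^ k * ∫⁻ x in A, ‖gradient g x‖ₑ) := by gcongr
      _ = K ^ (k + k) * ∫⁻ x in A, ‖gradient g x‖ₑ := by ring
  · calc ∫⁻ x in A, ‖gradient g x‖ₑ ≤ K ^ k * ∫⁻ t, h t := hle_int
      _ ≤ K ^ k * ∫⁻ t, K ^ k * μHE[finrank ℝ V - 1] (A ∩ {x | g x = t}) := by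
        gcongr with t
        exact hle_slice t
      _ = K ^ (k + k) * ∫⁻ t, μHE[finrank ℝ V - 1] (A ∩ {x | g x = t}) := by
        rw [lintegral_const_mul _ hmeas]; ring

/-- The coarea formula. -/
theorem lintegral_lintegral_inter_level (hg : ∀ x ∈ A, ContDiffAt ℝ 1 g x)
    (h0 : ∀ x ∈ A, gradient g x ≠ 0) (hA : MeasurableSet A) {f : V → ℝ≥0∞} (hf : Measurable f) :
    Measurable (fun t => ∫⁻ x in A ∩ {x | g x = t}, f x ∂μHE[finrank ℝ V - 1]) ∧
      ∫⁻ t, ∫⁻ x in A ∩ {x | g x = t}, f x ∂μHE[finrank ℝ V - 1] =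
        ∫⁻ x in A, f x * ‖gradient g x‖ₑ := by
  set κ : ℝ → Measure V := fun t => μHE[finrank ℝ V - 1].restrict (A ∩ {x | g x = t})
  have hκ_apply {B : Set V} (hB : MeasurableSet B) (t : ℝ) :
      κ t B = μHE[finrank ℝ V - 1] ((A ∩ B) ∩ {x | g x = t}) := by
    rw [restrict_apply hB, inter_left_comm, inter_assoc]
  have hgA (B : Set V) : ∀ x ∈ A ∩ B, ContDiffAt ℝ 1 g x := fun x hx => hg x hx.1
  have h0A (B : Set V) : ∀ x ∈ A ∩ B, gradient g x ≠ 0 := fun x hx => h0 x hx.1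
  have hκ : Measurable κ := measurable_of_measurable_coe _ fun B hB => by
    simpa only [hκ_apply hB] using
      measurable_euclideanHausdorffMeasure_inter_level (hgA B) (h0A B) (hA.inter hB)
  have hgrad : Measurable fun x => ‖gradient g x‖ₑ := by
    simpa only [enorm_gradient_eq_enorm_fderiv] using (measurable_fderiv ℝ g).enorm
  have hbind : Measure.bind volume κ =
      (volume.restrict A).withDensity fun x => ‖gradient g x‖ₑ := by
    ext B hB
    simp_rw [bind_apply hB hκ.aemeasurable, hκ_apply hB, withDensity_apply _ hB,
      restrict_restrict hB, inter_comm B]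
    exact lintegral_euclideanHausdorffMeasure_inter_level (hgA B) (h0A B) (hA.inter hB)
  refine ⟨(measurable_lintegral hf).comp hκ, ?_⟩
  rw [← lintegral_bind hκ.aemeasurable hf.aemeasurable, hbind,
    lintegral_withDensity_eq_lintegral_mul _ hgrad hf]
  simp_rw [Pi.mul_apply, mul_comm]

end CoareaFormula

section CriticalLevels

section Eilenberg

variable {X : Type*} [EMetricSpace X] [MeasurableSpace X] [BorelSpace X] {f : X → ℝ} {A : Set X}
  {L : ℝ≥0} {s : ℝ}

theorem exists_cover_tsum_le_hausdorffMeasure_add (hA : μH[s] A ≠ ∞) {ε : ℝ≥0∞} (hε : 0 < ε) :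
    ∃ S : ℕ → Set X, A ⊆ ⋃ i, S i ∧ (∀ i, Metric.ediam (S i) ≤ ε) ∧
      ∑' i, ⨆ _ : (S i).Nonempty, Metric.ediam (S i) ^ s ≤ μH[s] A + ε := by
  have hlt : (⨅ (S : ℕ → Set X) (_ : A ⊆ ⋃ i, S i) (_ : ∀ i, Metric.ediam (S i) ≤ ε),
      ∑' i, ⨆ _ : (S i).Nonempty, Metric.ediam (S i) ^ s) < μH[s] A + ε := by
    refine lt_of_le_of_lt ?_ (ENNReal.lt_add_right hA hε.ne')
    rw [hausdorffMeasure_apply]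
    exact le_iSup₂_of_le ε hε le_rfl
  simp only [iInf_lt_iff] at hlt
  obtain ⟨S, hAS, hSε, hS⟩ := hlt
  exact ⟨S, hAS, hSε, hS.le⟩

theorem exists_cover_tsum_mul_volume_le (hf : LipschitzOnWith L f A) (hs : 0 ≤ s)
    (hA : μH[s + 1] A ≠ ∞) {ε : ℝ≥0∞} (hε : 0 < ε) :
    ∃ (S : ℕ → Set X) (J : ℕ → Set ℝ), (∀ i, MeasurableSet (J i)) ∧
      (∀ i, Metric.ediam (S i) ≤ ε) ∧ (∀ x ∈ A, ∃ i, x ∈ S i ∧ f x ∈ J i) ∧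
      ∑' i, Metric.ediam (S i) ^ s * volume (J i) ≤ L * (μH[s + 1] A + ε) := by
  obtain ⟨S, hAS, hSε, hS⟩ := exists_cover_tsum_le_hausdorffMeasure_add hA hε
  refine ⟨S, fun i => closure (f '' (A ∩ S i)), fun i => measurableSet_closure, hSε,
    fun x hx => ?_, ?_⟩
  · obtain ⟨i, hi⟩ := mem_iUnion.1 (hAS hx)
    exact ⟨i, hi, subset_closure (mem_image_of_mem f ⟨hx, hi⟩)⟩
  refine le_trans ?_ (mul_le_mul_right hS (L : ℝ≥0∞))
  rw [← ENNReal.tsum_mul_left]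
  refine ENNReal.tsum_le_tsum fun i => ?_
  rcases (A ∩ S i).eq_empty_or_nonempty with he | hne
  · simp [he]
  rw [ciSup_pos (hne.mono inter_subset_right), ENNReal.rpow_add_of_nonneg _ _ hs zero_le_one,
    ENNReal.rpow_one, mul_left_comm]
  gcongr
  calc volume (closure (f '' (A ∩ S i)))
      ≤ Metric.ediam (f '' (A ∩ S i)) := by
        simpa only [Metric.ediam_closure] using Real.volume_le_diam (closure (f '' (A ∩ S i)))
    _ ≤ L * Metric.ediam (S i) := Metric.ediam_image_le_iff.2 fun x hx y hy =>
        (hf hx.1 hy.1).trans (by gcongr; exact Metric.edist_le_ediam_of_mem hx.2 hy.2)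

/-- Eilenberg's inequality, stated through a measurable majorant because `t ↦ μH[s] (A ∩ {f = t})`
need not be measurable. -/
theorem exists_measurable_hausdorffMeasure_inter_level_le
    (hf : LipschitzOnWith L f A) (hs : 0 ≤ s) (hA : μH[s + 1] A ≠ ∞) :
    ∃ h : ℝ → ℝ≥0∞, Measurable h ∧ (∀ t, μH[s] (A ∩ {x | f x = t}) ≤ h t) ∧
      ∫⁻ t, h t ≤ L * μH[s + 1] A := by
  obtain ⟨ε, -, hε, hε0⟩ := exists_seq_strictAnti_tendsto' (zero_lt_one' ℝ≥0∞)
  choose S J hJ hSε hcover hsum using fun n =>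
    exists_cover_tsum_mul_volume_le hf hs hA (hε n).1
  let h (n : ℕ) (t : ℝ) : ℝ≥0∞ := ∑' i, (J n i).indicator (fun _ => Metric.ediam (S n i) ^ s) t
  have hm (n : ℕ) : Measurable (h n) :=
    Measurable.tsum fun i => measurable_const.indicator (hJ n i)
  refine ⟨fun t => liminf (fun n => h n t) atTop, .liminf hm, fun t => ?_, ?_⟩
  · have hslice := hausdorffMeasure_le_liminf_tsum s (A ∩ {x | f x = t}) ε hε0
      (fun n (i : {i // t ∈ J n i}) => S n i) (.of_forall fun n i => hSε n i)
      (.of_forall fun n x hx => by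
        obtain ⟨i, hi, hti⟩ := hcover n x hx.1
        exact mem_iUnion.2 ⟨⟨i, hx.2 ▸ hti⟩, hi⟩)
    refine hslice.trans_eq (congrArg (liminf · atTop) (funext fun n => ?_))
    exact tsum_subtype {i | t ∈ J n i} fun i => Metric.ediam (S n i) ^ s
  · have hint (n : ℕ) : ∫⁻ t, h n t ≤ L * (μH[s + 1] A + ε n) := by
      refine le_of_eq_of_le ?_ (hsum n)
      rw [lintegral_tsum fun i => (measurable_const.indicator (hJ n i)).aemeasurable]
      simp only [lintegral_indicator_const (hJ n _)]
    have hlim : Tendsto (fun n => L * (μH[s + 1] A + ε n)) atTop (𝓝 (L * μH[s + 1] A)) := by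
      simpa using ENNReal.Tendsto.const_mul (tendsto_const_nhds.add hε0) (Or.inr (by simp))
    calc ∫⁻ t, liminf (fun n => h n t) atTop
        ≤ liminf (fun n => ∫⁻ t, h n t) atTop := lintegral_liminf_le hm
      _ ≤ liminf (fun n => L * (μH[s + 1] A + ε n)) atTop :=
        liminf_le_liminf (.of_forall hint)
      _ = L * μH[s + 1] A := hlim.liminf_eq

end Eilenberg

section Critical

variable {E : Type*} [NormedAddCommGroup E] [NormedSpace ℝ E] [SecondCountableTopology E]
  [MeasurableSpace E] [BorelSpace E] {g : E → ℝ} {C : Set E} {s : ℝ}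

theorem exists_measurable_hausdorffMeasure_inter_level_le_of_critical
    (hg : ∀ x ∈ C, HasStrictFDerivAt g (0 : E →L[ℝ] ℝ) x) (hs : 0 ≤ s) (hC : μH[s + 1] C ≠ ∞)
    {ε : ℝ≥0} (hε : 0 < ε) :
    ∃ h : ℝ → ℝ≥0∞, Measurable h ∧ (∀ t, μH[s] (C ∩ {x | g x = t}) ≤ h t) ∧
      ∫⁻ t, h t ≤ ε * μH[s + 1] C := by
  obtain ⟨D, hDm, hDd, hCD, hD⟩ := exists_measurable_partition_of_locally (A := C)
    (P := LipschitzOnWith ε g) (lipschitzOnWith_empty ε g) (fun _ _ hst ht => ht.mono hst)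
    fun x hx => (hg x hx).exists_lipschitzOnWith_of_nnnorm_lt ε (by simpa using hε)
  choose h hhm hle hint using fun n => exists_measurable_hausdorffMeasure_inter_level_le
    ((hD n).mono inter_subset_right) hs (ne_top_of_le_ne_top hC (measure_mono inter_subset_left))
  refine ⟨fun t => ∑' n, h n t, .tsum hhm, fun t => ?_, ?_⟩
  · calc μH[s] (C ∩ {x | g x = t})
        ≤ μH[s] (⋃ n, C ∩ D n ∩ {x | g x = t}) := measure_mono fun x hx => by
          obtain ⟨n, hn⟩ := mem_iUnion.1 (hCD hx.1)
          exact mem_iUnion.2 ⟨n, ⟨hx.1, hn⟩, hx.2⟩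
      _ ≤ ∑' n, μH[s] (C ∩ D n ∩ {x | g x = t}) := measure_iUnion_le _
      _ ≤ ∑' n, h n t := ENNReal.tsum_le_tsum fun n => hle n t
  · calc ∫⁻ t, ∑' n, h n t
        = ∑' n, ∫⁻ t, h n t := lintegral_tsum fun n => (hhm n).aemeasurable
      _ ≤ ∑' n, ε * (μH[s + 1].restrict C) (D n) := ENNReal.tsum_le_tsum fun n => by
        rw [Measure.restrict_apply (hDm n), inter_comm]
        exact hint n
      _ = ε * (μH[s + 1].restrict C) (⋃ n, D n) := by
        rw [ENNReal.tsum_mul_left, measure_iUnion hDd hDm]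
      _ ≤ ε * μH[s + 1] C := by
        rw [Measure.restrict_apply (.iUnion hDm)]
        gcongr
        exact inter_subset_right

theorem ae_hausdorffMeasure_inter_level_eq_zero_of_critical
    (hg : ∀ x ∈ C, HasStrictFDerivAt g (0 : E →L[ℝ] ℝ) x) (hs : 0 ≤ s) (hC : μH[s + 1] C ≠ ∞) :
    ∀ᵐ t : ℝ, μH[s] (C ∩ {x | g x = t}) = 0 := by
  obtain ⟨ε, -, hε, hε0⟩ := exists_seq_strictAnti_tendsto (0 : ℝ≥0)
  choose h hm hle hint using fun n =>
    exists_measurable_hausdorffMeasure_inter_level_le_of_critical hg hs hC (hε n)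
  have hlim : Tendsto (fun n => (ε n : ℝ≥0∞) * μH[s + 1] C) atTop (𝓝 0) := by
    simpa using ENNReal.Tendsto.mul_const (ENNReal.tendsto_coe.2 hε0) (Or.inr hC)
  have hzero : ∫⁻ t, liminf (fun n => h n t) atTop = 0 := le_antisymm
    (calc ∫⁻ t, liminf (fun n => h n t) atTop
        ≤ liminf (fun n => ∫⁻ t, h n t) atTop := lintegral_liminf_le hm
      _ ≤ liminf (fun n => (ε n : ℝ≥0∞) * μH[s + 1] C) atTop := liminf_le_liminf (.of_forall hint)
      _ = 0 := hlim.liminf_eq) zero_le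
  filter_upwards [(lintegral_eq_zero_iff (.liminf hm)).1 hzero] with t ht
  exact le_antisymm ((le_liminf_of_le (h := .of_forall fun n => hle n t)).trans_eq ht) zero_le

end Critical

/-- A substitute for Sard's theorem under `C¹` regularity: every level may contain critical points,
but almost every one contains only a null set of them. -/
theorem ae_euclideanHausdorffMeasure_inter_level_eq_zero_of_critical {V : Type*}
    [NormedAddCommGroup V] [InnerProductSpace ℝ V] [FiniteDimensional ℝ V] [Nontrivial V]
    [MeasurableSpace V] [BorelSpace V] {g : V → ℝ} {C : Set V}
    (hg : ∀ x ∈ C, ContDiffAt ℝ 1 g x ∧ gradient g x = 0) (hC : Bornology.IsBounded C) :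
    ∀ᵐ t : ℝ, μHE[finrank ℝ V - 1] (C ∩ {x | g x = t}) = 0 := by
  have hdim : ((finrank ℝ V - 1 : ℕ) : ℝ) + 1 = finrank ℝ V := by
    exact_mod_cast Nat.sub_add_cancel (finrank_pos (R := ℝ) (M := V))
  have hfin : μH[((finrank ℝ V - 1 : ℕ) : ℝ) + 1] C ≠ ∞ := by
    rw [hdim]
    exact hC.measure_lt_top.ne
  have hcrit (x : V) (hx : x ∈ C) : HasStrictFDerivAt g (0 : V →L[ℝ] ℝ) x := by
    have h0 : fderiv ℝ g x = 0 := by simpa [gradient] using (hg x hx).2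
    exact h0 ▸ (hg x hx).1.hasStrictFDerivAt one_ne_zero
  filter_upwards [ae_hausdorffMeasure_inter_level_eq_zero_of_critical hcrit
    (Nat.cast_nonneg _) hfin] with t ht
  rw [euclideanHausdorffMeasure_def, Measure.smul_apply, ht, smul_zero]

end CriticalLevels

section LevelIntegrals

section Coarea

variable {V : Type*} [NormedAddCommGroup V] [InnerProductSpace ℝ V]
  [MeasurableSpace V] [BorelSpace V] {Ω : Set V} {g f : V → ℝ}

/-- The integral of `f` over the part in `Ω` of the level set `{g = t}`, with respect to the
hypersurface measure. -/
noncomputable def levelIntegral (Ω : Set V) (g f : V → ℝ) (t : ℝ) : ℝ :=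
  ∫ x in {x ∈ Ω | g x = t}, f x ∂μHE[finrank ℝ V - 1]

theorem levelIntegral_eq_toReal (hf : Measurable f) (hf0 : 0 ≤ f) (t : ℝ) :
    levelIntegral Ω g f t =
      (∫⁻ x in {x ∈ Ω | g x = t}, ENNReal.ofReal (f x) ∂μHE[finrank ℝ V - 1]).toReal :=
  integral_eq_lintegral_of_nonneg_ae (.of_forall hf0) hf.aestronglyMeasurable

variable [FiniteDimensional ℝ V]

theorem measurable_gradient (g : V → ℝ) : Measurable (gradient g) :=
  (InnerProductSpace.toDual ℝ V).symm.continuous.measurable.comp (measurable_fderiv ℝ g)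

variable [Nontrivial V]

theorem ae_restrict_level_eq_restrict_regular (ho : IsOpen Ω) (hb : Bornology.IsBounded Ω)
    (hg : ContDiffOn ℝ 1 g Ω) :
    ∀ᵐ t : ℝ, (μHE[finrank ℝ V - 1] : Measure V).restrict {x ∈ Ω | g x = t} =
      μHE[finrank ℝ V - 1].restrict ({x ∈ Ω | gradient g x ≠ 0} ∩ {x | g x = t}) := by
  filter_upwards [ae_euclideanHausdorffMeasure_inter_level_eq_zero_of_critical
    (C := {x ∈ Ω | gradient g x = 0})
    (fun x hx => ⟨hg.contDiffAt (ho.mem_nhds hx.1), hx.2⟩) (hb.subset (sep_subset _ _))] with t ht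
  refine restrict_congr_set (EventuallyLE.antisymm (ae_le_set.2 (measure_mono_null ?_ ht))
    (LE.le.eventuallyLE fun x hx => ⟨hx.1.1, hx.2⟩))
  exact fun x hx => ⟨⟨hx.1.1, by_contra fun hne => hx.2 ⟨⟨hx.1.1, hne⟩, hx.1.2⟩⟩, hx.1.2⟩

theorem lintegral_lintegral_level (ho : IsOpen Ω) (hb : Bornology.IsBounded Ω)
    (hg : ContDiffOn ℝ 1 g Ω) {f : V → ℝ≥0∞} (hf : Measurable f) :
    AEMeasurable (fun t => ∫⁻ x in {x ∈ Ω | g x = t}, f x ∂μHE[finrank ℝ V - 1]) ∧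
      ∫⁻ t, ∫⁻ x in {x ∈ Ω | g x = t}, f x ∂μHE[finrank ℝ V - 1] =
        ∫⁻ x in Ω, f x * ‖gradient g x‖ₑ := by
  set R : Set V := {x ∈ Ω | gradient g x ≠ 0}
  have hne : MeasurableSet {x | gradient g x ≠ 0} :=
    measurable_gradient g (measurableSet_singleton 0).compl
  obtain ⟨hmeas, hcoarea⟩ := lintegral_lintegral_inter_level
    (fun x (hx : x ∈ R) => hg.contDiffAt (ho.mem_nhds hx.1)) (fun x hx => hx.2)
    (ho.measurableSet.inter hne) hf
  have hlevel : (fun t => ∫⁻ x in {x ∈ Ω | g x = t}, f x ∂μHE[finrank ℝ V - 1]) =ᵐ[volume]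
      fun t => ∫⁻ x in R ∩ {x | g x = t}, f x ∂μHE[finrank ℝ V - 1] := by
    filter_upwards [ae_restrict_level_eq_restrict_regular ho hb hg] with t ht
    rw [ht]
  refine ⟨hmeas.aemeasurable.congr hlevel.symm, ?_⟩
  rw [lintegral_congr_ae hlevel, hcoarea]
  have hsupp : (fun x => f x * ‖gradient g x‖ₑ).support ⊆ {x | gradient g x ≠ 0} :=
    fun x hx h0 => hx (by simp [h0])
  rw [← setLIntegral_eq_of_support_subset hsupp (μ := volume.restrict Ω), restrict_restrict hne,
    inter_comm]
  rfl

theorem lintegral_mul_lintegral_level (ho : IsOpen Ω) (hb : Bornology.IsBounded Ω)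
    (hg : ContDiffOn ℝ 1 g Ω) {f : V → ℝ≥0∞} (hf : Measurable f) {ψ : ℝ → ℝ≥0∞}
    (hψ : Measurable ψ) :
    ∫⁻ t, ψ t * ∫⁻ x in {x ∈ Ω | g x = t}, f x ∂μHE[finrank ℝ V - 1] =
      ∫⁻ x in Ω, ψ (g x) * (f x * ‖gradient g x‖ₑ) := by
  classical
  have hg' : Measurable (Ω.piecewise g 0) :=
    hg.continuousOn.measurable_piecewise continuousOn_const ho.measurableSet
  have hcongr {x : V} (hx : x ∈ Ω) : Ω.piecewise g 0 x = g x := piecewise_eq_of_mem _ _ _ hx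
  have h := (lintegral_lintegral_level ho hb hg ((hψ.comp hg').mul hf)).2
  simp only [Pi.mul_apply, Function.comp_apply, mul_assoc] at h
  rw [setLIntegral_congr_fun ho.measurableSet
    (fun x hx => by rw [hcongr hx] : EqOn _ (fun x => ψ (g x) * (f x * ‖gradient g x‖ₑ)) Ω)] at h
  rw [← h]
  refine lintegral_congr fun t => ?_
  rw [← lintegral_const_mul _ hf]
  refine setLIntegral_congr_fun (measurableSet_inter_level hg.continuousOn ho.measurableSet t)
    fun x hx => ?_
  rw [hcongr hx.1, hx.2]

theorem lintegral_level_ne_top (ho : IsOpen Ω) (hb : Bornology.IsBounded Ω)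
    (hg : ContDiffOn ℝ 1 g Ω) (hf : Measurable f)
    (hfi : IntegrableOn (fun x => f x * ‖gradient g x‖) Ω) :
    ∫⁻ t, ∫⁻ x in {x ∈ Ω | g x = t}, ENNReal.ofReal (f x) ∂μHE[finrank ℝ V - 1] ≠ ∞ := by
  rw [(lintegral_lintegral_level ho hb hg hf.ennreal_ofReal).2]
  refine ne_of_eq_of_ne (lintegral_congr fun x => ?_) hfi.lintegral_lt_top.ne
  rw [ENNReal.ofReal_mul' (norm_nonneg _), ofReal_norm]

theorem ae_integrableOn_level (ho : IsOpen Ω) (hb : Bornology.IsBounded Ω)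
    (hg : ContDiffOn ℝ 1 g Ω) (hf : Measurable f) (hf0 : 0 ≤ f)
    (hfi : IntegrableOn (fun x => f x * ‖gradient g x‖) Ω) :
    ∀ᵐ t : ℝ, IntegrableOn f {x ∈ Ω | g x = t} μHE[finrank ℝ V - 1] := by
  filter_upwards [ae_lt_top' (lintegral_lintegral_level ho hb hg hf.ennreal_ofReal).1
    (lintegral_level_ne_top ho hb hg hf hfi)] with t ht
  exact ⟨hf.aestronglyMeasurable, (hasFiniteIntegral_iff_ofReal (.of_forall hf0)).2 ht⟩

theorem integrable_levelIntegral (ho : IsOpen Ω) (hb : Bornology.IsBounded Ω)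
    (hg : ContDiffOn ℝ 1 g Ω) (hf : Measurable f) (hf0 : 0 ≤ f)
    (hfi : IntegrableOn (fun x => f x * ‖gradient g x‖) Ω) :
    Integrable (levelIntegral Ω g f) := by
  rw [funext (levelIntegral_eq_toReal hf hf0)]
  exact integrable_toReal_of_lintegral_ne_top
    (lintegral_lintegral_level ho hb hg hf.ennreal_ofReal).1
    (lintegral_level_ne_top ho hb hg hf hfi)

theorem integral_mul_levelIntegral (ho : IsOpen Ω) (hb : Bornology.IsBounded Ω)
    (hg : ContDiffOn ℝ 1 g Ω) (hf : Measurable f) (hf0 : 0 ≤ f)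
    (hfi : IntegrableOn (fun x => f x * ‖gradient g x‖) Ω)
    {ψ : ℝ → ℝ} (hψ : Measurable ψ) (hψ0 : 0 ≤ ψ) :
    ∫ t, ψ t * levelIntegral Ω g f t = ∫ x in Ω, ψ (g x) * (f x * ‖gradient g x‖) := by
  have hmeas := (lintegral_lintegral_level ho hb hg hf.ennreal_ofReal).1
  calc ∫ t, ψ t * levelIntegral Ω g f t
      = ∫ t, (ENNReal.ofReal (ψ t) * ∫⁻ x in {x ∈ Ω | g x = t}, ENNReal.ofReal (f x)
          ∂μHE[finrank ℝ V - 1]).toReal := by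
        simp only [levelIntegral_eq_toReal hf hf0, ENNReal.toReal_mul,
          ENNReal.toReal_ofReal (hψ0 _)]
    _ = (∫⁻ x in Ω, ENNReal.ofReal (ψ (g x)) *
          (ENNReal.ofReal (f x) * ‖gradient g x‖ₑ)).toReal := by
        rw [integral_toReal (f := fun t => ENNReal.ofReal (ψ t) * ∫⁻ x in {x ∈ Ω | g x = t}, _ ∂_)
            (hψ.ennreal_ofReal.aemeasurable.mul hmeas),
          lintegral_mul_lintegral_level ho hb hg hf.ennreal_ofReal hψ.ennreal_ofReal]
        filter_upwards [ae_lt_top' hmeas (lintegral_level_ne_top ho hb hg hf hfi)] with t ht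
        exact ENNReal.mul_lt_top ENNReal.ofReal_lt_top ht
    _ = ∫ x in Ω, ψ (g x) * (f x * ‖gradient g x‖) := by
        rw [integral_eq_lintegral_of_nonneg_ae
          (.of_forall fun x => mul_nonneg (hψ0 _) (mul_nonneg (hf0 x) (norm_nonneg _)))]
        · simp only [ENNReal.ofReal_mul (hψ0 _), ENNReal.ofReal_mul (hf0 _), ofReal_norm]
        · exact (hψ.comp_aemeasurable
            (hg.continuousOn.aemeasurable ho.measurableSet)).aestronglyMeasurable.mul
            hfi.aestronglyMeasurable

end Coarea

section LayerCake

variable {X : Type*} {g q : X → ℝ} {M : ℝ} {ψ : ℝ → ℝ}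

theorem setIntegral_Ioc_indicator_lt {x : X} (hx0 : 0 ≤ g x) (hxM : g x ≤ M) :
    ∫ t in Ioc 0 M, {p : ℝ × X | p.1 < g p.2}.indicator (fun p => ψ p.1 * q p.2) (t, x) =
      q x * ∫ s in (0 : ℝ)..g x, ψ s := by
  have hset : Iio (g x) ∩ Ioc 0 M = Ioo 0 (g x) := by
    ext t
    simp only [mem_inter_iff, mem_Iio, mem_Ioc, mem_Ioo]
    exact ⟨fun h => ⟨h.2.1, h.1⟩, fun h => ⟨h.2, h.1, h.2.le.trans hxM⟩⟩
  calc ∫ t in Ioc 0 M, (Iio (g x)).indicator (fun t => ψ t * q x) t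
      = (∫ t in Ioo 0 (g x), ψ t) * q x := by
        rw [integral_indicator measurableSet_Iio, restrict_restrict measurableSet_Iio, hset,
          integral_mul_const]
    _ = q x * ∫ s in (0 : ℝ)..g x, ψ s := by
        rw [mul_comm, intervalIntegral.integral_of_le hx0, integral_Ioc_eq_integral_Ioo]

variable [MeasurableSpace X] {μ : Measure X}

/-- The integral of `q` over the superlevel set `{g > t}`. -/
noncomputable def superlevelIntegral (μ : Measure X) (g q : X → ℝ) (t : ℝ) : ℝ :=
  ∫ x in {x | t < g x}, q x ∂μ

theorem superlevelIntegral_eq_zero (hgM : ∀ᵐ x ∂μ, g x ≤ M) {t : ℝ} (ht : M ≤ t) :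
    superlevelIntegral μ g q t = 0 := by
  have h0 : μ {x | t < g x} = 0 :=
    measure_mono_null (fun x hx (hxM : g x ≤ M) => (hxM.trans ht).not_gt hx) (ae_iff.1 hgM)
  rw [superlevelIntegral, restrict_eq_zero.2 h0, integral_zero_measure]

theorem integral_indicator_lt_eq (hg : AEMeasurable g μ) (t : ℝ) :
    ∫ x, {p : ℝ × X | p.1 < g p.2}.indicator (fun p => ψ p.1 * q p.2) (t, x) ∂μ =
      ψ t * superlevelIntegral μ g q t := by
  rw [superlevelIntegral, ← integral_const_mul]
  exact integral_indicator₀ (nullMeasurableSet_lt aemeasurable_const hg)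

theorem integrable_indicator_lt (hg : AEMeasurable g μ) (hq : Integrable q μ)
    (hψ : IntegrableOn ψ (Ioc 0 M)) :
    Integrable ({p : ℝ × X | p.1 < g p.2}.indicator fun p => ψ p.1 * q p.2)
      ((volume.restrict (Ioc 0 M)).prod μ) :=
  (hψ.mul_prod hq).indicator₀ (nullMeasurableSet_lt measurable_fst.aemeasurable hg.comp_snd)

variable [SFinite μ]

theorem integrableOn_superlevelIntegral (hg : AEMeasurable g μ) (hgM : ∀ᵐ x ∂μ, g x ≤ M)
    (hq : Integrable q μ) : IntegrableOn (superlevelIntegral μ g q) (Ioi 0) := by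
  have h := (integrable_indicator_lt (M := M) (ψ := fun _ => 1) hg hq
    (integrableOn_const (by simp) (by simp))).integral_prod_left
  rw [funext (integral_indicator_lt_eq (ψ := fun _ => 1) hg)] at h
  simp only [one_mul] at h
  refine IntegrableOn.of_forall_sdiff_eq_zero h measurableSet_Ioi fun t ht => ?_
  exact superlevelIntegral_eq_zero hgM (not_le.1 fun htM => ht.2 ⟨ht.1, htM⟩).le

theorem setIntegral_mul_superlevelIntegral (hg : AEMeasurable g μ) (hg0 : ∀ᵐ x ∂μ, 0 ≤ g x)
    (hgM : ∀ᵐ x ∂μ, g x ≤ M) (hq : Integrable q μ) (hψ : IntegrableOn ψ (Ioc 0 M)) :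
    ∫ t in Ioi 0, ψ t * superlevelIntegral μ g q t = ∫ x, (q x * ∫ s in (0 : ℝ)..g x, ψ s) ∂μ := by
  have hswap := integral_integral_swap (f := fun t x =>
    {p : ℝ × X | p.1 < g p.2}.indicator (fun p => ψ p.1 * q p.2) (t, x))
    (integrable_indicator_lt hg hq hψ)
  simp only [integral_indicator_lt_eq hg] at hswap
  rw [setIntegral_eq_of_subset_of_forall_sdiff_eq_zero measurableSet_Ioi Ioc_subset_Ioi_self, hswap]
  · refine integral_congr_ae ?_
    filter_upwards [hg0, hgM] with x hx0 hxM using setIntegral_Ioc_indicator_lt hx0 hxM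
  · exact fun t ht => by
      rw [superlevelIntegral_eq_zero hgM (not_le.1 fun htM => ht.2 ⟨ht.1, htM⟩).le, mul_zero]

end LayerCake

section TestFunctions

variable {α : Type*} [EMetricSpace α] [MeasurableSpace α] [BorelSpace α] {μ : Measure α}
  {F : α → ℝ}

theorem setIntegral_nonneg_of_isClosed_of_forall_continuous (hF : Integrable F μ)
    (h : ∀ ψ : α → ℝ, Continuous ψ → 0 ≤ ψ → ψ ≤ 1 → 0 ≤ ∫ t, ψ t * F t ∂μ)
    {S : Set α} (hS : IsClosed S) : 0 ≤ ∫ t in S, F t ∂μ := by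
  have hpos (n : ℕ) : (0 : ℝ) < 1 / ((n : ℝ) + 1) := by positivity
  let ψ (n : ℕ) (t : α) : ℝ := thickenedIndicator (hpos n) S t
  have hψc (n : ℕ) : Continuous (ψ n) :=
    NNReal.continuous_coe.comp (thickenedIndicator (hpos n) S).continuous
  have hψ1 (n : ℕ) (t : α) : ψ n t ≤ 1 :=
    NNReal.coe_le_one.2 (thickenedIndicator_le_one (hpos n) S t)
  have hψ (t : α) : Tendsto (fun n => ψ n t * F t) atTop (𝓝 (S.indicator F t)) := by
    have hlim := tendsto_pi_nhds.1 (thickenedIndicator_tendsto_indicator_closure hpos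
      tendsto_one_div_add_atTop_nhds_zero_nat S) t
    have hlim' := ((NNReal.continuous_coe.tendsto _).comp hlim).mul_const (F t)
    rw [hS.closure_eq] at hlim'
    refine hlim'.trans_eq (congrArg 𝓝 ?_)
    by_cases ht : t ∈ S <;> simp [ht]
  have hlim : Tendsto (fun n => ∫ t, ψ n t * F t ∂μ) atTop (𝓝 (∫ t, S.indicator F t ∂μ)) :=
    tendsto_integral_of_dominated_convergence (fun t => ‖F t‖)
      (fun n => (hψc n).aestronglyMeasurable.mul hF.aestronglyMeasurable) hF.norm
      (fun n => .of_forall fun t => by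
        rw [norm_mul, Real.norm_of_nonneg (NNReal.coe_nonneg _)]
        exact mul_le_of_le_one_left (norm_nonneg _) (hψ1 n t))
      (.of_forall hψ)
  rw [← integral_indicator hS.measurableSet]
  exact ge_of_tendsto' hlim fun n => h _ (hψc n) (fun t => NNReal.coe_nonneg _) (hψ1 n)

theorem ae_nonneg_of_forall_continuous_integral_nonneg [μ.InnerRegular] (hF : Integrable F μ)
    (h : ∀ ψ : α → ℝ, Continuous ψ → 0 ≤ ψ → ψ ≤ 1 → 0 ≤ ∫ t, ψ t * F t ∂μ) : 0 ≤ᵐ[μ] F := by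
  by_contra hneg
  have hA : NullMeasurableSet {t | F t < 0} μ :=
    nullMeasurableSet_lt hF.aestronglyMeasurable.aemeasurable aemeasurable_const
  obtain ⟨B, hBF, hBm, hB⟩ := hA.exists_measurable_subset_ae_eq
  have hB0 : 0 < μ B := by
    rw [measure_congr hB, pos_iff_ne_zero]
    exact fun h0 => hneg <| (measure_eq_zero_iff_ae_notMem.1 h0).mono fun t ht => not_lt.1 ht
  obtain ⟨S, hSB, hSc, hS0⟩ := hBm.exists_lt_isCompact hB0
  have hFS (t : α) (ht : t ∈ S) : 0 < -F t := neg_pos.2 (hBF (hSB ht))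
  have hpos : 0 < ∫ t in S, -F t ∂μ := by
    rw [setIntegral_pos_iff_support_of_nonneg_ae _ (f := fun t => -F t) hF.neg.integrableOn]
    · exact hS0.trans_le (measure_mono fun t ht => ⟨(hFS t ht).ne', ht⟩)
    · exact ae_restrict_of_forall_mem hSc.measurableSet fun t ht => (hFS t ht).le
  rw [integral_neg, neg_pos] at hpos
  exact hpos.not_ge
    (setIntegral_nonneg_of_isClosed_of_forall_continuous hF h hSc.isClosed)

end TestFunctions

end LevelIntegrals

section LevelInequality

theorem superlevelIntegral_restrict {X : Type*} [MeasurableSpace X] {μ : Measure X} {Ω : Set X}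
    {g : X → ℝ} (hg : AEMeasurable g (μ.restrict Ω)) (q : X → ℝ) (t : ℝ) :
    superlevelIntegral (μ.restrict Ω) g q t = ∫ x in {x ∈ Ω | t < g x}, q x ∂μ := by
  have hset : {x ∈ Ω | t < g x} = {x | t < g x} ∩ Ω := inter_comm _ _
  rw [superlevelIntegral, restrict_restrict₀ (nullMeasurableSet_lt aemeasurable_const hg), hset]

variable {V : Type*} [NormedAddCommGroup V] [InnerProductSpace ℝ V] [MeasurableSpace V]
  [BorelSpace V] {Ω : Set V} {g f f₁ f₂ q : V → ℝ} {M : ℝ} {ψ c : ℝ → ℝ}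

theorem levelIntegral_eq_zero (hgM : ∀ x ∈ Ω, g x ∈ Icc 0 M) {t : ℝ} (ht : t ∉ Icc 0 M) :
    levelIntegral Ω g f t = 0 := by
  have hempty : {x ∈ Ω | g x = t} = ∅ :=
    eq_empty_of_forall_notMem fun x ⟨hx, hxt⟩ => ht (hxt ▸ hgM x hx)
  rw [levelIntegral, hempty, setIntegral_empty]

variable [FiniteDimensional ℝ V] [Nontrivial V]

theorem setIntegral_mul_levelIntegral (ho : IsOpen Ω) (hb : Bornology.IsBounded Ω)
    (hg : ContDiffOn ℝ 1 g Ω) (hgM : ∀ x ∈ Ω, g x ∈ Icc 0 M) (hf : Measurable f) (hf0 : 0 ≤ f)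
    (hfi : IntegrableOn (fun x => f x * ‖gradient g x‖) Ω) (hψ : Measurable ψ) (hψ0 : 0 ≤ ψ) :
    ∫ t in Ioi 0, ψ t * levelIntegral Ω g f t =
      ∫ x in Ω, ψ (g x) * (f x * ‖gradient g x‖) := by
  rw [← integral_mul_levelIntegral ho hb hg hf hf0 hfi hψ hψ0, ← integral_Ici_eq_integral_Ioi]
  refine setIntegral_eq_integral_of_forall_compl_eq_zero fun t ht => ?_
  rw [levelIntegral_eq_zero hgM fun h => ht h.1, mul_zero]

theorem integrable_mul_levelIntegral (ho : IsOpen Ω) (hb : Bornology.IsBounded Ω)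
    (hg : ContDiffOn ℝ 1 g Ω) (hgM : ∀ x ∈ Ω, g x ∈ Icc 0 M) (hf : Measurable f) (hf0 : 0 ≤ f)
    (hfi : IntegrableOn (fun x => f x * ‖gradient g x‖) Ω) (hψ : Continuous ψ) :
    Integrable fun t => ψ t * levelIntegral Ω g f t := by
  have hsupp : Function.support (fun t => ψ t * levelIntegral Ω g f t) ⊆ Icc 0 M :=
    Function.support_subset_iff'.2 fun t ht => by rw [levelIntegral_eq_zero hgM ht, mul_zero]
  exact (integrableOn_iff_integrable_of_support_subset hsupp).1
    ((integrable_levelIntegral ho hb hg hf hf0 hfi).integrableOn.continuousOn_mul hψ.continuousOn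
      isCompact_Icc)

/-- An inequality between integrals over almost all level sets follows from its integrated form
against test functions `ψ`, by the coarea and layer cake formulas. -/
theorem ae_levelIntegral_le (ho : IsOpen Ω) (hb : Bornology.IsBounded Ω)
    (hg : ContDiffOn ℝ 1 g Ω) (hgM : ∀ x ∈ Ω, g x ∈ Icc 0 M)
    (hf₁ : Measurable f₁) (hf₁0 : 0 ≤ f₁)
    (hf₁i : IntegrableOn (fun x => f₁ x * ‖gradient g x‖) Ω)
    (hf₂ : Measurable f₂) (hf₂0 : 0 ≤ f₂)
    (hf₂i : IntegrableOn (fun x => f₂ x * ‖gradient g x‖) Ω) (hq : IntegrableOn q Ω)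
    (hc : Continuous c) (hc0 : 0 ≤ c)
    (h : ∀ ψ : ℝ → ℝ, Continuous ψ → 0 ≤ ψ →
      ∫ x in Ω, ψ (g x) * (f₁ x * ‖gradient g x‖) ≤
        (∫ x in Ω, ψ (g x) * c (g x) * (f₂ x * ‖gradient g x‖)) +
          ∫ x in Ω, q x * ∫ s in (0 : ℝ)..g x, ψ s) :
    ∀ᵐ t : ℝ, 0 < t → levelIntegral Ω g f₁ t ≤
      c t * levelIntegral Ω g f₂ t + ∫ x in {x ∈ Ω | t < g x}, q x := by
  have hgΩ : AEMeasurable g (volume.restrict Ω) :=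
    hg.continuousOn.aemeasurable ho.measurableSet
  have hg0 : ∀ᵐ x ∂volume.restrict Ω, 0 ≤ g x :=
    ae_restrict_of_forall_mem ho.measurableSet fun x hx => (hgM x hx).1
  have hgM' : ∀ᵐ x ∂volume.restrict Ω, g x ≤ M :=
    ae_restrict_of_forall_mem ho.measurableSet fun x hx => (hgM x hx).2
  have hI₁ := integrable_levelIntegral ho hb hg hf₁ hf₁0 hf₁i
  have hI₂ := integrable_mul_levelIntegral ho hb hg hgM hf₂ hf₂0 hf₂i hc
  have hJ := integrableOn_superlevelIntegral hgΩ hgM' hq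
  have hnonneg := ae_nonneg_of_forall_continuous_integral_nonneg
    ((hI₂.integrableOn.add hJ).sub hI₁.integrableOn) fun ψ hψ hψ0 hψ1 => by
    have hψI {H : ℝ → ℝ} (hH : Integrable H (volume.restrict (Ioi 0))) :
        Integrable (fun t => ψ t * H t) (volume.restrict (Ioi 0)) :=
      hH.bdd_mul hψ.aestronglyMeasurable (.of_forall fun t =>
        (Real.norm_of_nonneg (hψ0 t)).trans_le (hψ1 t))
    have hψcI₂ := setIntegral_mul_levelIntegral ho hb hg hgM hf₂ hf₂0 hf₂i
      (hψ.mul hc).measurable (mul_nonneg hψ0 hc0)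
    simp only [Pi.mul_apply, Pi.sub_apply, Pi.add_apply, mul_sub, mul_add, mul_assoc] at hψcI₂ ⊢
    rw [integral_sub ((hψI hI₂.integrableOn).fun_add (hψI hJ)) (hψI hI₁.integrableOn),
      integral_add (hψI hI₂.integrableOn) (hψI hJ), hψcI₂,
      setIntegral_mul_superlevelIntegral hgΩ hg0 hgM' hq hψ.integrableOn_Ioc,
      setIntegral_mul_levelIntegral ho hb hg hgM hf₁ hf₁0 hf₁i hψ.measurable hψ0]
    simpa only [mul_assoc, sub_nonneg] using h ψ hψ hψ0
  filter_upwards [(ae_restrict_iff' measurableSet_Ioi).1 hnonneg] with t ht htpos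
  rw [← superlevelIntegral_restrict hgΩ]
  exact sub_nonneg.1 (ht htpos)

end LevelInequality

end Coarea

section Divergence

section Cutoff

variable {E : Type*} [PseudoMetricSpace E] {Ω : Set E} {x : E}

/-- A Lipschitz cutoff function, equal to `1` at depth at least `δ` in `Ω` and to `0` off `Ω`. -/
noncomputable def boundaryCutoff (Ω : Set E) (δ : ℝ) (x : E) : ℝ :=
  min 1 (Metric.infDist x Ωᶜ / δ)

theorem boundaryCutoff_nonneg {δ : ℝ} (hδ : 0 ≤ δ) (x : E) : 0 ≤ boundaryCutoff Ω δ x :=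
  le_min zero_le_one (div_nonneg Metric.infDist_nonneg hδ)

theorem boundaryCutoff_eq_one {δ : ℝ} (hδ : 0 < δ) (hx : δ ≤ Metric.infDist x Ωᶜ) :
    boundaryCutoff Ω δ x = 1 :=
  min_eq_left ((one_le_div hδ).2 hx)

theorem boundaryCutoff_eq_zero (δ : ℝ) (hx : x ∉ Ω) : boundaryCutoff Ω δ x = 0 := by
  rw [boundaryCutoff, Metric.infDist_zero_of_mem (mem_compl hx), zero_div,
    min_eq_right zero_le_one]

theorem exists_lipschitzWith_boundaryCutoff (Ω : Set E) (δ : ℝ) :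
    ∃ D, LipschitzWith D (boundaryCutoff Ω δ) := by
  have heq : boundaryCutoff Ω δ = fun x => min 1 (δ⁻¹ • Metric.infDist x Ωᶜ) :=
    funext fun x => by rw [boundaryCutoff, div_eq_inv_mul, smul_eq_mul]
  exact ⟨_, heq ▸
    ((lipschitzWith_smul (δ⁻¹ : ℝ)).comp (Metric.lipschitz_infDist_pt Ωᶜ)).const_min 1⟩

theorem infDist_compl_pos (ho : IsOpen Ω) (hΩ : Ω ≠ univ) (hx : x ∈ Ω) :
    0 < Metric.infDist x Ωᶜ :=
  (ho.isClosed_compl.notMem_iff_infDist_pos (nonempty_compl.2 hΩ)).1 (not_not_intro hx)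

theorem tendsto_measureReal_inter_infDist_compl_lt [MeasurableSpace E] [OpensMeasurableSpace E]
    {μ : Measure E} (ho : IsOpen Ω) (hΩ : Ω ≠ univ) (hμ : μ Ω ≠ ∞) {δ : ℕ → ℝ} (hδ : Antitone δ)
    (hδ0 : Tendsto δ atTop (𝓝 0)) :
    Tendsto (fun n => μ.real (Ω ∩ {x | Metric.infDist x Ωᶜ < δ n})) atTop (𝓝 0) := by
  have hempty : ⋂ n, Ω ∩ {x | Metric.infDist x Ωᶜ < δ n} = ∅ := by
    refine eq_empty_of_forall_notMem fun x hx => ?_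
    rw [mem_iInter] at hx
    exact (infDist_compl_pos ho hΩ (hx 0).1).not_ge
      (ge_of_tendsto' hδ0 fun n => (hx n).2.le)
  have hlim := tendsto_measure_iInter_atTop (μ := μ)
    (fun n => (ho.inter (isOpen_lt (Metric.continuous_infDist_pt Ωᶜ)
      continuous_const)).measurableSet.nullMeasurableSet)
    (fun _ _ hnk => inter_subset_inter_right Ω fun _ hx => lt_of_lt_of_le hx (hδ hnk))
    ⟨0, ((measure_mono inter_subset_left).trans_lt hμ.lt_top).ne⟩
  rw [hempty, measure_empty] at hlim
  exact (ENNReal.tendsto_toReal ENNReal.zero_ne_top).comp hlim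

end Cutoff

section Distance

variable {E : Type*} [NormedAddCommGroup E] [NormedSpace ℝ E] {Ω : Set E} {x y : E}

/-- The continuous linear functional `ℓ` supports `Ω` at `y`: the set lies in the half-space
`{ℓ ≤ ℓ y}`. -/
def IsSupportingAt (Ω : Set E) (y : E) (ℓ : E →L[ℝ] ℝ) : Prop :=
  ∀ z ∈ Ω, ℓ (z - y) ≤ 0

theorem eventually_add_smul_lt {f : E → ℝ} {L : E →L[ℝ] ℝ} (h : HasFDerivAt f L y) {u : E} {c : ℝ}
    (hu : L u < c) : ∀ᶠ s : ℝ in 𝓝[>] 0, f (y + s • u) < f y + s * c := by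
  have hslope := (h.hasLineDerivAt u).hasDerivWithinAt (s := Ioi 0)
  rw [hasDerivWithinAt_iff_tendsto_slope' self_notMem_Ioi] at hslope
  filter_upwards [hslope.eventually_lt_const hu, self_mem_nhdsWithin] with s hs (hs0 : 0 < s)
  rw [slope_def_field, sub_zero, div_lt_iff₀ hs0, zero_smul, add_zero] at hs
  linarith

theorem ball_add_smul_subset_of_convex (hc : Convex ℝ Ω) {r s : ℝ} (hr : Metric.ball x r ⊆ Ω)
    {z : E} (hz : z ∈ Ω) (hs0 : 0 ≤ s) (hs1 : s < 1) :
    Metric.ball (x + s • (z - x)) ((1 - s) * r) ⊆ Ω := by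
  intro w hw
  have h1s : 0 < 1 - s := sub_pos.2 hs1
  have hw' : x + (1 - s)⁻¹ • (w - (x + s • (z - x))) ∈ Ω := by
    refine hr ?_
    rw [mem_ball_iff_norm] at hw
    rw [mem_ball_iff_norm, add_sub_cancel_left, norm_smul, norm_inv, Real.norm_of_nonneg h1s.le]
    exact (inv_mul_lt_iff₀ h1s).2 hw
  convert hc hw' hz h1s.le hs0 (sub_add_cancel 1 s) using 1
  rw [smul_add, smul_inv_smul₀ h1s.ne']
  module

theorem neg_infDist_compl_le_fderiv_apply_sub (hc : Convex ℝ Ω) (hΩ : Ω ≠ univ)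
    (hd : DifferentiableAt ℝ (Metric.infDist · Ωᶜ) x) {z : E} (hz : z ∈ Ω) :
    -Metric.infDist x Ωᶜ ≤ fderiv ℝ (Metric.infDist · Ωᶜ) x (z - x) := by
  by_contra! hlt
  obtain ⟨s, hs, hs0, hs1⟩ :=
    ((eventually_add_smul_lt hd.hasFDerivAt hlt).and (Ioo_mem_nhdsGT one_pos)).exists
  have hball := ball_add_smul_subset_of_convex hc
    (Metric.ball_infDist_compl_subset (x := x)) hz hs0.le hs1
  have hle : (1 - s) * Metric.infDist x Ωᶜ ≤ Metric.infDist (x + s • (z - x)) Ωᶜ :=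
    (Metric.le_infDist (nonempty_compl.2 hΩ)).2 fun w hw => by
      by_contra! hdist
      exact hw (hball (Metric.mem_ball'.2 hdist))
  linarith

theorem fderiv_infDist_compl_apply_sub_le (hy : y ∉ Ω) (hxy : Metric.infDist x Ωᶜ = dist x y)
    (hd : DifferentiableAt ℝ (Metric.infDist · Ωᶜ) x) :
    fderiv ℝ (Metric.infDist · Ωᶜ) x (y - x) ≤ -Metric.infDist x Ωᶜ := by
  by_contra! hlt
  have hlt' : (-fderiv ℝ (Metric.infDist · Ωᶜ) x) (y - x) < Metric.infDist x Ωᶜ := neg_lt.1 hlt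
  obtain ⟨s, hs, -, hs1⟩ :=
    ((eventually_add_smul_lt hd.hasFDerivAt.neg hlt').and (Ioo_mem_nhdsGT one_pos)).exists
  have hle : Metric.infDist (x + s • (y - x)) Ωᶜ ≤ (1 - s) * Metric.infDist x Ωᶜ := by
    refine (Metric.infDist_le_dist_of_mem hy).trans_eq ?_
    rw [hxy, dist_eq_norm, dist_eq_norm, ← Real.norm_of_nonneg (sub_nonneg.2 hs1.le), ← norm_smul]
    congr 1
    module
  simp only [Pi.neg_apply] at hs
  linarith

theorem exists_isSupportingAt_neg_fderiv_infDist_compl [FiniteDimensional ℝ E] (ho : IsOpen Ω)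
    (hc : Convex ℝ Ω) (hΩ : Ω ≠ univ) (hx : x ∈ Ω)
    (hd : DifferentiableAt ℝ (Metric.infDist · Ωᶜ) x) :
    ∃ y ∈ frontier Ω, Metric.infDist x Ωᶜ = dist x y ∧
      IsSupportingAt Ω y (-fderiv ℝ (Metric.infDist · Ωᶜ) x) := by
  obtain ⟨y, hy, hxy⟩ := exists_mem_frontier_infDist_compl_eq_dist hx hΩ
  refine ⟨y, hy, hxy, fun z hz => ?_⟩
  have hyΩ : y ∉ Ω := fun hyΩ => ho.inter_frontier_eq.subset ⟨hyΩ, hy⟩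
  have hz := neg_infDist_compl_le_fderiv_apply_sub hc hΩ hd hz
  have hy := fderiv_infDist_compl_apply_sub_le hyΩ hxy hd
  rw [neg_apply, ← sub_sub_sub_cancel_right z y x, map_sub]
  linarith

/-- Where the cutoff varies its gradient is `δ⁻¹` times that of the distance to the boundary, and
the field at the nearest boundary point does not point outwards. -/
theorem neg_fderiv_boundaryCutoff_apply_le [FiniteDimensional ℝ E] (ho : IsOpen Ω)
    (hc : Convex ℝ Ω) (hΩ : Ω ≠ univ) {X : E → E} {C : ℝ≥0} (hX : LipschitzOnWith C X (closure Ω))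
    (hn : ∀ y ∈ frontier Ω, ∀ ℓ, IsSupportingAt Ω y ℓ → ℓ (X y) ≤ 0) {δ : ℝ} (hδ : 0 < δ)
    (hd : DifferentiableAt ℝ (Metric.infDist · Ωᶜ) x) (hx : x ∈ Ω)
    (hxδ : Metric.infDist x Ωᶜ < δ) :
    -fderiv ℝ (boundaryCutoff Ω δ) x (X x) ≤ C := by
  have hcut : boundaryCutoff Ω δ =ᶠ[𝓝 x] fun z => δ⁻¹ * Metric.infDist z Ωᶜ := by
    filter_upwards [(Metric.continuous_infDist_pt Ωᶜ).continuousAt.eventually_lt_const hxδ]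
      with z hz
    rw [boundaryCutoff, min_eq_right ((div_le_one hδ).2 hz.le), div_eq_inv_mul]
  obtain ⟨y, hy, hxy, hsupp⟩ := exists_isSupportingAt_neg_fderiv_infDist_compl ho hc hΩ hx hd
  set L := fderiv ℝ (Metric.infDist · Ωᶜ) x
  have hL : ‖L‖ ≤ 1 := norm_fderiv_le_of_lipschitz ℝ (Metric.lipschitz_infDist_pt Ωᶜ)
  have hdiff : L (X y - X x) ≤ C * δ :=
    calc L (X y - X x) ≤ 1 * ‖X y - X x‖ := (le_abs_self _).trans (L.le_of_opNorm_le hL _)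
      _ ≤ C * dist x y := by
        rw [one_mul, ← dist_eq_norm, dist_comm x y]
        exact hX.dist_le_mul y (frontier_subset_closure hy) x (subset_closure hx)
      _ ≤ C * δ := by rw [← hxy]; gcongr
  have hXy : -L (X y) ≤ 0 := hn y hy _ hsupp
  rw [map_sub] at hdiff
  rw [hcut.fderiv_eq, fderiv_const_mul hd, smul_apply, smul_eq_mul, ← mul_neg,
    inv_mul_le_iff₀ hδ, mul_comm δ]
  linarith

theorem fderiv_boundaryCutoff_eq_zero {δ : ℝ} (hδ : 0 < δ)
    (hx : x ∈ Ω → δ ≤ Metric.infDist x Ωᶜ) : fderiv ℝ (boundaryCutoff Ω δ) x = 0 := by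
  by_cases hxΩ : x ∈ Ω
  · refine IsLocalMax.fderiv_eq_zero (.of_forall fun z => ?_)
    rw [boundaryCutoff_eq_one hδ (hx hxΩ)]
    exact min_le_left _ _
  · refine IsLocalMin.fderiv_eq_zero (.of_forall fun z => ?_)
    rw [boundaryCutoff_eq_zero δ hxΩ]
    exact boundaryCutoff_nonneg hδ.le z

end Distance

section Parts

variable {E : Type*} [NormedAddCommGroup E] [NormedSpace ℝ E] [FiniteDimensional ℝ E]
  [MeasurableSpace E] [BorelSpace E] {μ : Measure E} {f h : E → ℝ} {C D : ℝ≥0}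

theorem integrable_fderiv_apply_mul [IsLocallyFiniteMeasure μ] (hf : LipschitzWith C f)
    (hh : Continuous h) (hs : HasCompactSupport h) (u : E) :
    Integrable (fun x => fderiv ℝ f x u * h x) μ :=
  (hh.integrable_of_hasCompactSupport hs).bdd_mul
    (measurable_fderiv_apply_const ℝ f u).aestronglyMeasurable
    (.of_forall fun x => (fderiv ℝ f x).le_of_opNorm_le (norm_fderiv_le_of_lipschitz ℝ hf) u)

theorem integrable_fderiv_apply [IsLocallyFiniteMeasure μ] {X : E → E} (hX : Continuous X)
    (hh : LipschitzWith D h) (hs : HasCompactSupport h) :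
    Integrable (fun x => fderiv ℝ h x (X x)) μ := by
  have hsupp : Function.support (fun x => fderiv ℝ h x (X x)) ⊆ tsupport h := fun x hx =>
    support_fderiv_subset ℝ fun h0 => hx (by simp only [h0, zero_apply])
  rw [← integrableOn_iff_integrable_of_support_subset hsupp]
  have hmeas : Measurable fun x => fderiv ℝ h x (X x) :=
    isBoundedBilinearMap_apply.continuous.measurable.comp
      ((measurable_fderiv ℝ h).prodMk hX.measurable)
  exact ((hX.continuousOn.integrableOn_compact hs).norm.const_mul (D : ℝ)).mono'
    hmeas.aestronglyMeasurable
    (.of_forall fun x => (fderiv ℝ h x).le_of_opNorm_le (norm_fderiv_le_of_lipschitz ℝ hh) _)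

theorem integral_fderiv_apply_mul_eq [μ.IsAddHaarMeasure] (hf : LipschitzWith C f)
    (hh : LipschitzWith D h) (hs : HasCompactSupport h) (u : E) :
    ∫ x, fderiv ℝ f x u * h x ∂μ = -∫ x, f x * fderiv ℝ h x u ∂μ := by
  have hparts := hf.integral_lineDeriv_mul_eq (μ := μ) hh hs u
  rw [← integral_neg]
  convert hparts using 1
  · refine integral_congr_ae ?_
    filter_upwards [hf.ae_differentiableAt] with x hx
    rw [hx.lineDeriv_eq_fderiv]
  · refine integral_congr_ae ?_
    filter_upwards [hh.ae_differentiableAt] with x hx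
    rw [hx.lineDeriv_eq_fderiv, map_neg]
    ring

end Parts

variable {d : ℕ} {Ω : Set (𝔼 d)} {X : 𝔼 d → 𝔼 d} {C : ℝ≥0}

theorem sum_apply_single_mul (L : 𝔼 d →L[ℝ] ℝ) (u : 𝔼 d) :
    ∑ i, u i * L (EuclideanSpace.single i 1) = L u := by
  conv_rhs => rw [← (EuclideanSpace.basisFun (Fin d) ℝ).sum_repr u]
  simp [map_sum]

theorem integral_divergence_mul_eq (hX : LipschitzWith C X) {h : 𝔼 d → ℝ} {D : ℝ≥0}
    (hh : LipschitzWith D h) (hs : HasCompactSupport h) :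
    ∫ x, divergence X x * h x = -∫ x, fderiv ℝ h x (X x) := by
  have hXi (i : Fin d) : LipschitzWith C fun x => X x i :=
    .of_dist_le_mul fun x y =>
      (PiLp.norm_apply_le (X x - X y) i).trans ((dist_eq_norm (X x) (X y)).ge.trans
        (hX.dist_le_mul x y))
  have hsum (x : 𝔼 d) :
      fderiv ℝ h x (X x) = ∑ i, X x i * fderiv ℝ h x (EuclideanSpace.single i 1) :=
    (sum_apply_single_mul _ _).symm
  have hint (i : Fin d) :
      Integrable fun x => X x i * fderiv ℝ h x (EuclideanSpace.single i 1) := by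
    have hcont : Continuous fun x => X x i • EuclideanSpace.single i (1 : ℝ) :=
      (hXi i).continuous.smul continuous_const
    simpa only [map_smul, smul_eq_mul] using integrable_fderiv_apply hcont hh hs
  simp only [divergence, partialD, Finset.sum_mul, hsum]
  rw [integral_finsetSum _ fun i _ => integrable_fderiv_apply_mul (hXi i) hh.continuous hs _,
    integral_finsetSum _ fun i _ => hint i, ← Finset.sum_neg_distrib]
  exact Finset.sum_congr rfl fun i _ => integral_fderiv_apply_mul_eq (hXi i) hh hs _

theorem divergence_congr (ho : IsOpen Ω) {Y : 𝔼 d → 𝔼 d} (hXY : EqOn X Y Ω) {x : 𝔼 d}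
    (hx : x ∈ Ω) : divergence X x = divergence Y x := by
  refine Finset.sum_congr rfl fun i _ => ?_
  have hcoord : (fun y => X y i) =ᶠ[𝓝 x] fun y => Y y i :=
    (hXY.eventuallyEq_of_mem (ho.mem_nhds hx)).fun_comp fun y : 𝔼 d => y i
  rw [partialD, partialD, hcoord.fderiv_eq]

theorem setIntegral_divergence_mul_boundaryCutoff_le (ho : IsOpen Ω) (hb : Bornology.IsBounded Ω)
    (hc : Convex ℝ Ω) (hΩ : Ω ≠ univ) (hX : LipschitzOnWith C X (closure Ω))
    (hn : ∀ y ∈ frontier Ω, ∀ ℓ, IsSupportingAt Ω y ℓ → ℓ (X y) ≤ 0) {δ : ℝ} (hδ : 0 < δ) :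
    ∫ x in Ω, divergence X x * boundaryCutoff Ω δ x ≤
      C * volume.real (Ω ∩ {x | Metric.infDist x Ωᶜ < δ}) := by
  obtain ⟨Y, hY, hXY⟩ := hX.extend_finite_dimension
  obtain ⟨D, hD⟩ := exists_lipschitzWith_boundaryCutoff Ω δ
  have hsupp : HasCompactSupport (boundaryCutoff Ω δ) :=
    HasCompactSupport.intro hb.isCompact_closure fun x hx =>
      boundaryCutoff_eq_zero δ fun h => hx (subset_closure h)
  have hlayer : MeasurableSet (Ω ∩ {x | Metric.infDist x Ωᶜ < δ}) :=
    (ho.inter (isOpen_lt (Metric.continuous_infDist_pt _) continuous_const)).measurableSet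
  have hae : ∀ᵐ x, -fderiv ℝ (boundaryCutoff Ω δ) x (Y x) ≤
      (Ω ∩ {x | Metric.infDist x Ωᶜ < δ}).indicator (fun _ => (C : ℝ)) x := by
    filter_upwards [(Metric.lipschitz_infDist_pt Ωᶜ).ae_differentiableAt] with x hd
    by_cases hx : x ∈ Ω ∩ {x | Metric.infDist x Ωᶜ < δ}
    · rw [indicator_of_mem hx, ← hXY (subset_closure hx.1)]
      exact neg_fderiv_boundaryCutoff_apply_le ho hc hΩ hX hn hδ hd hx.1 hx.2
    · rw [indicator_of_notMem hx, fderiv_boundaryCutoff_eq_zero hδ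
        fun hxΩ => not_lt.1 fun h => hx ⟨hxΩ, h⟩]
      simp
  calc ∫ x in Ω, divergence X x * boundaryCutoff Ω δ x
      = ∫ x in Ω, divergence Y x * boundaryCutoff Ω δ x :=
        setIntegral_congr_fun ho.measurableSet fun x hx => by
          rw [divergence_congr ho (hXY.mono subset_closure) hx]
    _ = ∫ x, -fderiv ℝ (boundaryCutoff Ω δ) x (Y x) := by
        rw [integral_neg, ← integral_divergence_mul_eq hY hD hsupp]
        exact setIntegral_eq_integral_of_forall_compl_eq_zero fun x hx => by
          rw [boundaryCutoff_eq_zero δ hx, mul_zero]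
    _ ≤ ∫ x, (Ω ∩ {x | Metric.infDist x Ωᶜ < δ}).indicator (fun _ => (C : ℝ)) x :=
        integral_mono_ae (integrable_fderiv_apply (μ := volume) hY.continuous hD hsupp).neg
          ((integrable_indicator_iff hlayer).2 (integrableOn_const
            (measure_inter_lt_top_of_left_ne_top hb.measure_lt_top.ne).ne)) hae
    _ = C * volume.real (Ω ∩ {x | Metric.infDist x Ωᶜ < δ}) := by
        rw [integral_indicator_const _ hlayer, smul_eq_mul, mul_comm]

theorem setIntegral_divergence_nonpos [Nontrivial (𝔼 d)] (ho : IsOpen Ω)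
    (hb : Bornology.IsBounded Ω) (hc : Convex ℝ Ω) (hX : LipschitzOnWith C X (closure Ω))
    (hi : IntegrableOn (divergence X) Ω)
    (hn : ∀ y ∈ frontier Ω, ∀ ℓ, IsSupportingAt Ω y ℓ → ℓ (X y) ≤ 0) :
    ∫ x in Ω, divergence X x ≤ 0 := by
  have hΩ : Ω ≠ univ := fun h => NormedSpace.unbounded_univ ℝ (𝔼 d) (h ▸ hb)
  have hδ (n : ℕ) : (0 : ℝ) < 1 / ((n : ℝ) + 1) := Nat.one_div_pos_of_nat
  have hlim := tendsto_one_div_add_atTop_nhds_zero_nat (𝕜 := ℝ)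
  have hleft : Tendsto (fun n : ℕ => ∫ x in Ω,
      divergence X x * boundaryCutoff Ω (1 / ((n : ℝ) + 1)) x) atTop
      (𝓝 (∫ x in Ω, divergence X x)) := by
    refine tendsto_integral_of_dominated_convergence (fun x => ‖divergence X x‖) (fun n => ?_)
      hi.norm (fun n => .of_forall fun x => ?_)
      (ae_restrict_of_forall_mem ho.measurableSet fun x hx => ?_)
    · obtain ⟨D, hD⟩ := exists_lipschitzWith_boundaryCutoff Ω (1 / ((n : ℝ) + 1))
      exact hi.aestronglyMeasurable.mul hD.continuous.aestronglyMeasurable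
    · rw [norm_mul, Real.norm_of_nonneg (boundaryCutoff_nonneg (hδ n).le x)]
      exact mul_le_of_le_one_right (norm_nonneg _) (min_le_left _ _)
    · refine tendsto_const_nhds.congr' ?_
      filter_upwards [hlim.eventually_lt_const (infDist_compl_pos ho hΩ hx)] with n hn
      rw [boundaryCutoff_eq_one (hδ n) hn.le, mul_one]
  have hright := (tendsto_measureReal_inter_infDist_compl_lt (μ := volume) ho hΩ
    hb.measure_lt_top.ne (fun _ _ => Nat.one_div_le_one_div) hlim).const_mul (C : ℝ)
  rw [mul_zero] at hright
  exact le_of_tendsto_of_tendsto' hleft hright fun n =>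
    setIntegral_divergence_mul_boundaryCutoff_le ho hb hc hΩ hX hn (hδ n)

end Divergence

section Boundary

theorem exists_curve_in_level {E : Type*} [NormedAddCommGroup E] [NormedSpace ℝ E]
    [CompleteSpace E] {f : E → ℝ} {L : E →L[ℝ] ℝ} {y u : E}
    (hf : HasStrictFDerivAt f L y) (hL : L ≠ 0) (hu : L u = 0) :
    ∃ γ : ℝ → E, γ 0 = y ∧ HasDerivAt γ u 0 ∧ ∀ᶠ s in 𝓝 0, f (γ s) = f y := by
  have hrange : L.range = ⊤ := LinearMap.range_eq_top.2
    (LinearMap.surjective fun h => hL (ContinuousLinearMap.coe_injective h))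
  set w : L.ker := ⟨u, hu⟩
  have hline : HasDerivAt (fun s : ℝ => s • w) w 0 := by
    simpa using (hasDerivAt_id (0 : ℝ)).smul_const w
  refine ⟨fun s => hf.implicitFunction f L hrange (f y) (s • w), ?_, ?_, ?_⟩
  · simp only [zero_smul, hf.implicitFunction_apply_image]
  · have himp := (hf.to_implicitFunction hrange).hasFDerivAt
    rw [← zero_smul ℝ w] at himp
    exact himp.comp_hasDerivAt 0 hline
  · have hlim : Tendsto (fun s : ℝ => (f y, s • w)) (𝓝 0) (𝓝 (f y, 0)) := by
      have h := hline.continuousAt.tendsto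
      rw [zero_smul] at h
      exact tendsto_const_nhds.prodMk_nhds h
    exact hlim.eventually (hf.map_implicitFunction_eq hrange)

theorem IsSupportingAt.closure {E : Type*} [NormedAddCommGroup E] [NormedSpace ℝ E] {Ω : Set E}
    {y : E} {ℓ : E →L[ℝ] ℝ} (h : IsSupportingAt Ω y ℓ) : IsSupportingAt (closure Ω) y ℓ :=
  fun _ hz => closure_minimal (t := {z | ℓ (z - y) ≤ 0}) h
    (isClosed_le (by fun_prop) continuous_const) hz

variable {d : ℕ} {Ω U : Set (𝔼 d)} {ρ : 𝔼 d → ℝ} {v : 𝔼 d → 𝔼 d} {p q y u : 𝔼 d}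

/-- A vector field tangent to the boundary of `Ω`. -/
def IsTangentToFrontier (Ω : Set (𝔼 d)) (v : 𝔼 d → 𝔼 d) : Prop :=
  ∀ p ∈ frontier Ω, ∀ n, IsUnitOutwardNormal Ω p n → inner ℝ (v p) n = 0

namespace IsC2DefiningFunction

theorem contDiffAt (h : IsC2DefiningFunction Ω p U ρ) (hq : q ∈ U) : ContDiffAt ℝ 2 ρ q :=
  h.contDiffOn.contDiffAt (h.isOpen.mem_nhds hq)

theorem hasFDerivAt (h : IsC2DefiningFunction Ω p U ρ) (hq : q ∈ U) :
    HasFDerivAt ρ (fderiv ℝ ρ q) q :=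
  ((h.contDiffAt hq).differentiableAt two_ne_zero).hasFDerivAt

theorem fderiv_ne_zero (h : IsC2DefiningFunction Ω p U ρ) : fderiv ℝ ρ p ≠ 0 := fun h0 =>
  h.gradient_ne_zero (by rw [gradient, h0, map_zero])

theorem congr_base (h : IsC2DefiningFunction Ω p U ρ) (hq : q ∈ U) (hne : fderiv ℝ ρ q ≠ 0) :
    IsC2DefiningFunction Ω q U ρ :=
  ⟨h.isOpen, hq, h.contDiffOn, h.inter_eq, EmbeddingLike.map_ne_zero_iff.2 hne⟩

theorem neg_iff (h : IsC2DefiningFunction Ω p U ρ) (hq : q ∈ U) : ρ q < 0 ↔ q ∈ Ω := by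
  simpa only [mem_inter_iff, hq, and_true, mem_ofPred_eq, true_and] using
    (Set.ext_iff.1 h.inter_eq q).symm

theorem eq_zero (h : IsC2DefiningFunction Ω p U ρ) (ho : IsOpen Ω) (hq : q ∈ U)
    (hqf : q ∈ frontier Ω) : ρ q = 0 := by
  rw [ho.frontier_eq] at hqf
  refine le_antisymm (not_lt.1 fun hpos => ?_) (not_lt.1 fun hlt => hqf.2 ((h.neg_iff hq).1 hlt))
  obtain ⟨z, hzΩ, hz, hzU⟩ := ((mem_closure_iff_frequently.1 hqf.1).and_eventually
    (((h.contDiffAt hq).continuousAt.eventually_const_lt hpos).and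
      (h.isOpen.mem_nhds hq))).exists
  exact ((h.neg_iff hzU).2 hzΩ).not_gt hz

theorem eventually_add_smul_mem (h : IsC2DefiningFunction Ω p U ρ) (hq : q ∈ U) (u : 𝔼 d) :
    ∀ᶠ s : ℝ in 𝓝[>] 0, q + s • u ∈ U := by
  have hcont : ContinuousAt (fun s : ℝ => q + s • u) 0 := by fun_prop
  refine nhdsWithin_le_nhds (hcont.preimage_mem_nhds ?_)
  simpa using h.isOpen.mem_nhds hq

theorem eventually_add_smul_mem_of_neg (h : IsC2DefiningFunction Ω p U ρ) (hq : q ∈ U)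
    (hρ : ρ q = 0) (hu : fderiv ℝ ρ q u < 0) : ∀ᶠ s : ℝ in 𝓝[>] 0, q + s • u ∈ Ω := by
  filter_upwards [eventually_add_smul_lt (h.hasFDerivAt hq) hu, h.eventually_add_smul_mem hq u]
    with s hs hsU
  rw [hρ, mul_zero, add_zero] at hs
  exact (h.neg_iff hsU).1 hs

theorem exists_fderiv_neg (h : IsC2DefiningFunction Ω p U ρ) : ∃ u, fderiv ℝ ρ p u < 0 := by
  by_contra! hall
  refine h.fderiv_ne_zero (ContinuousLinearMap.ext fun u => le_antisymm ?_ (hall u))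
  rw [zero_apply, ← neg_nonneg, ← map_neg]
  exact hall (-u)

theorem mem_frontier (h : IsC2DefiningFunction Ω p U ρ) (ho : IsOpen Ω) (hρ : ρ p = 0) :
    p ∈ frontier Ω := by
  obtain ⟨u, hu⟩ := h.exists_fderiv_neg
  have hlim : Tendsto (fun s : ℝ => p + s • u) (𝓝[>] 0) (𝓝 p) := by
    have hcont : ContinuousAt (fun s : ℝ => p + s • u) 0 := by fun_prop
    simpa using hcont.tendsto.mono_left nhdsWithin_le_nhds
  rw [ho.frontier_eq]
  exact ⟨mem_closure_of_tendsto hlim (h.eventually_add_smul_mem_of_neg h.mem hρ hu), fun hp =>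
    ((h.neg_iff h.mem).2 hp).ne hρ⟩

theorem exists_curve_in_frontier (h : IsC2DefiningFunction Ω y U ρ) (ho : IsOpen Ω)
    (hy : y ∈ frontier Ω) (hu : fderiv ℝ ρ y u = 0) :
    ∃ γ : ℝ → 𝔼 d, γ 0 = y ∧ HasDerivAt γ u 0 ∧
      ∀ᶠ s in 𝓝 0, γ s ∈ frontier Ω ∧ IsC2DefiningFunction Ω (γ s) U ρ := by
  obtain ⟨γ, hγ0, hγ, hlevel⟩ := exists_curve_in_level
    ((h.contDiffAt h.mem).hasStrictFDerivAt two_ne_zero) h.fderiv_ne_zero hu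
  have hlim : Tendsto γ (𝓝 0) (𝓝 y) := hγ0 ▸ hγ.continuousAt.tendsto
  have hcont : ContinuousAt (fderiv ℝ ρ) y :=
    ((h.contDiffAt h.mem).fderiv_right (m := 1) le_rfl).continuousAt
  refine ⟨γ, hγ0, hγ, ?_⟩
  filter_upwards [hlevel, hlim.eventually (h.isOpen.mem_nhds h.mem),
    hlim.eventually (hcont.eventually_ne h.fderiv_ne_zero)] with s hs hsU hsne
  have hγs := h.congr_base hsU hsne
  exact ⟨hγs.mem_frontier ho (hs.trans (h.eq_zero ho h.mem hy)), hγs⟩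

theorem isSupportingAt_fderiv (h : IsC2DefiningFunction Ω y U ρ) (ho : IsOpen Ω)
    (hc : Convex ℝ Ω) (hy : y ∈ frontier Ω) : IsSupportingAt Ω y (fderiv ℝ ρ y) := by
  intro z hz
  by_contra! hpos
  have hneg : (-fderiv ℝ ρ y) (z - y) < 0 := neg_lt_zero.2 hpos
  obtain ⟨s, hs, hsU, hs0⟩ := ((eventually_add_smul_lt (h.hasFDerivAt h.mem).neg hneg).and
    ((h.eventually_add_smul_mem h.mem (z - y)).and (Ioo_mem_nhdsGT zero_lt_one))).exists
  have hmem : y + s • (z - y) ∈ Ω := by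
    have hseg := hc.openSegment_closure_interior_subset_interior (frontier_subset_closure hy)
      (ho.interior_eq.symm ▸ hz)
    rw [ho.interior_eq, openSegment_eq_image'] at hseg
    exact hseg ⟨s, hs0, rfl⟩
  simp only [Pi.neg_apply, h.eq_zero ho h.mem hy] at hs
  linarith [(h.neg_iff hsU).2 hmem]

/-- The outward normal direction is unique. -/
theorem apply_nonpos_of_isSupportingAt (h : IsC2DefiningFunction Ω y U ρ) (ho : IsOpen Ω)
    (hy : y ∈ frontier Ω) {ℓ : 𝔼 d →L[ℝ] ℝ} (hℓ : IsSupportingAt Ω y ℓ)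
    (hu : fderiv ℝ ρ y u ≤ 0) : ℓ u ≤ 0 := by
  have hstrict (w : 𝔼 d) (hw : fderiv ℝ ρ y w < 0) : ℓ w ≤ 0 := by
    obtain ⟨s, hs, hs0⟩ := ((h.eventually_add_smul_mem_of_neg h.mem
      (h.eq_zero ho h.mem hy) hw).and self_mem_nhdsWithin).exists
    have hsw := hℓ _ hs
    rw [add_sub_cancel_left, map_smul, smul_eq_mul] at hsw
    exact nonpos_of_mul_nonpos_right hsw hs0
  obtain ⟨w, hw⟩ := h.exists_fderiv_neg
  have hlim : Tendsto (fun ε : ℝ => ℓ (u + ε • w)) (𝓝[>] 0) (𝓝 (ℓ u)) := by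
    have hcont : ContinuousAt (fun ε : ℝ => ℓ (u + ε • w)) 0 := by fun_prop
    simpa using hcont.tendsto.mono_left nhdsWithin_le_nhds
  refine le_of_tendsto hlim (eventually_mem_nhdsWithin.mono fun ε hε => hstrict _ ?_)
  rw [map_add, map_smul, smul_eq_mul]
  linarith [mul_neg_of_pos_of_neg hε hw]

theorem fderiv_apply_eq_zero (h : IsC2DefiningFunction Ω y U ρ) (hy : y ∈ frontier Ω)
    (hv : IsTangentToFrontier Ω v) : fderiv ℝ ρ y (v y) = 0 := by
  have hinner := hv y hy _ ⟨U, ρ, h, rfl⟩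
  rw [inner_smul_right, mul_eq_zero, or_iff_right (inv_ne_zero (norm_ne_zero_iff.2
    h.gradient_ne_zero)), real_inner_comm, inner_gradient_left] at hinner
  exact hinner

theorem hasFDerivAt_fderiv (h : IsC2DefiningFunction Ω y U ρ) :
    HasFDerivAt (fderiv ℝ ρ) (fderiv ℝ (fderiv ℝ ρ) y) y :=
  (((h.contDiffAt h.mem).fderiv_right (m := 1) le_rfl).differentiableAt one_ne_zero).hasFDerivAt

/-- The second fundamental form of the boundary of a convex domain is nonnegative: along a curve in
the boundary, the supporting half-spaces at two points contain each other's base point. -/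
theorem fderiv_fderiv_apply_self_nonneg (h : IsC2DefiningFunction Ω y U ρ) (ho : IsOpen Ω)
    (hc : Convex ℝ Ω) (hy : y ∈ frontier Ω) (hu : fderiv ℝ ρ y u = 0) :
    0 ≤ fderiv ℝ (fderiv ℝ ρ) y u u := by
  obtain ⟨γ, rfl, hγ, hfrontier⟩ := h.exists_curve_in_frontier ho hy hu
  have hslope := (isBoundedBilinearMap_apply.continuous.tendsto _).comp
    ((h.hasFDerivAt_fderiv.comp_hasDerivAt 0 hγ).tendsto_slope.prodMk_nhds hγ.tendsto_slope)
  refine ge_of_tendsto hslope ?_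
  filter_upwards [nhdsWithin_le_nhds hfrontier] with s ⟨hs, hsρ⟩
  have hs0 := (hsρ.isSupportingAt_fderiv ho hc hs).closure _ (frontier_subset_closure hy)
  have h0s := (h.isSupportingAt_fderiv ho hc hy).closure _ (frontier_subset_closure hs)
  rw [← neg_sub, map_neg] at hs0
  simp only [slope, vsub_eq_sub, Function.comp_apply, smul_apply, sub_apply, map_smul, smul_eq_mul,
    ← mul_assoc]
  exact mul_nonneg (mul_self_nonneg _) (by linarith)

/-- Differentiate the tangency of `v` along a curve in the boundary with velocity `v y`. -/
theorem fderiv_apply_apply_nonpos (h : IsC2DefiningFunction Ω y U ρ) (ho : IsOpen Ω)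
    (hc : Convex ℝ Ω) (hy : y ∈ frontier Ω) (hv : IsTangentToFrontier Ω v)
    {A : 𝔼 d →L[ℝ] 𝔼 d} (hA : HasFDerivWithinAt v A (closure Ω) y) :
    fderiv ℝ ρ y (A (v y)) ≤ 0 := by
  have hNv := h.fderiv_apply_eq_zero hy hv
  obtain ⟨γ, rfl, hγ, hfrontier⟩ := h.exists_curve_in_frontier ho hy hNv
  have hvγ : HasDerivAt (v ∘ γ) (A (v (γ 0))) 0 :=
    (hA.comp_hasDerivWithinAt 0 hγ.hasDerivWithinAt fun _ hs => hs).hasDerivAt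
      (hfrontier.mono fun s hs => frontier_subset_closure hs.1)
  have hprod := (h.hasFDerivAt_fderiv.comp_hasDerivAt 0 hγ).clm_apply hvγ
  have hzero : (fun s => (fderiv ℝ ρ ∘ γ) s ((v ∘ γ) s)) =ᶠ[𝓝 0] fun _ => 0 :=
    hfrontier.mono fun s hs => hs.2.fderiv_apply_eq_zero hs.1 hv
  have hderiv := hprod.unique ((hasDerivAt_const 0 0).congr_of_eventuallyEq hzero)
  simp only [Function.comp_apply] at hderiv
  linarith [h.fderiv_fderiv_apply_self_nonneg ho hc hy hNv]

end IsC2DefiningFunction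

end Boundary

section Calculus

section ClosedDomain

variable {E F : Type*} [NormedAddCommGroup E] [NormedSpace ℝ E] [NormedAddCommGroup F]
  [NormedSpace ℝ F] {Ω : Set E} {f : E → F} {x : E}

theorem fderivWithin_closure_eq (ho : IsOpen Ω) (hx : x ∈ Ω) :
    fderivWithin ℝ f (closure Ω) x = fderiv ℝ f x :=
  fderivWithin_of_mem_nhds (mem_of_superset (ho.mem_nhds hx) subset_closure)

theorem contDiffAt_of_contDiffOn_closure {n : WithTop ℕ∞} (hf : ContDiffOn ℝ n f (closure Ω))
    (ho : IsOpen Ω) (hx : x ∈ Ω) : ContDiffAt ℝ n f x :=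
  hf.contDiffAt (mem_of_superset (ho.mem_nhds hx) subset_closure)

theorem uniqueDiffOn_closure_of_isOpen_of_convex (ho : IsOpen Ω) (hc : Convex ℝ Ω) :
    UniqueDiffOn ℝ (closure Ω) := by
  rcases Ω.eq_empty_or_nonempty with rfl | hne
  · simp only [closure_empty, uniqueDiffOn_empty]
  · exact uniqueDiffOn_convex hc.closure (hne.mono (interior_maximal subset_closure ho))

end ClosedDomain

section Trace

variable (E : Type*) [NormedAddCommGroup E] [NormedSpace ℝ E] [FiniteDimensional ℝ E]

/-- The trace of a continuous endomorphism, as a continuous linear functional. -/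
noncomputable def traceCLM : (E →L[ℝ] E) →L[ℝ] ℝ :=
  (LinearMap.trace ℝ E ∘ₗ ContinuousLinearMap.coeLM ℝ).toContinuousLinearMap

variable {E} {Ω : Set E} {v : E → E} {x : E}

theorem traceCLM_smulRight (ℓ : E →L[ℝ] ℝ) (u : E) : traceCLM E (ℓ.smulRight u) = ℓ u :=
  LinearMap.trace_smulRight (ℓ : E →ₗ[ℝ] ℝ) u

/-- The field `Dv v - (div v) v`, the derivatives being taken within the closed domain. -/
noncomputable def convectionField (Ω : Set E) (v : E → E) (x : E) : E :=
  fderivWithin ℝ v (closure Ω) x (v x) - traceCLM E (fderivWithin ℝ v (closure Ω) x) • v x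

theorem convectionField_eq (ho : IsOpen Ω) (hx : x ∈ Ω) :
    convectionField Ω v x = fderiv ℝ v x (v x) - traceCLM E (fderiv ℝ v x) • v x := by
  rw [convectionField, fderivWithin_closure_eq ho hx]

theorem contDiffOn_convectionField (ho : IsOpen Ω) (hc : Convex ℝ Ω)
    (hv : ContDiffOn ℝ 2 v (closure Ω)) : ContDiffOn ℝ 1 (convectionField Ω v) (closure Ω) := by
  have hD : ContDiffOn ℝ 1 (fderivWithin ℝ v (closure Ω)) (closure Ω) :=
    hv.fderivWithin (uniqueDiffOn_closure_of_isOpen_of_convex ho hc) le_rfl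
  have hv1 : ContDiffOn ℝ 1 v (closure Ω) := hv.of_le one_le_two
  exact (hD.clm_apply hv1).sub (((traceCLM E).contDiff.comp_contDiffOn hD).smul hv1)

/-- The second derivatives of `v` cancel by symmetry. -/
theorem traceCLM_fderiv_convectionField (ho : IsOpen Ω) (hv : ContDiffOn ℝ 2 v (closure Ω))
    (hx : x ∈ Ω) :
    traceCLM E (fderiv ℝ (convectionField Ω v) x) =
      traceCLM E ((fderiv ℝ v x).comp (fderiv ℝ v x)) - traceCLM E (fderiv ℝ v x) ^ 2 := by
  have hvx : ContDiffAt ℝ 2 v x := contDiffAt_of_contDiffOn_closure hv ho hx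
  have hD : HasFDerivAt v (fderiv ℝ v x) x := (hvx.differentiableAt two_ne_zero).hasFDerivAt
  have hD' : HasFDerivAt (fderiv ℝ v) (fderiv ℝ (fderiv ℝ v) x) x :=
    ((hvx.fderiv_right (m := 1) le_rfl).differentiableAt one_ne_zero).hasFDerivAt
  have hsymm : (fderiv ℝ (fderiv ℝ v) x).flip (v x) = fderiv ℝ (fderiv ℝ v) x (v x) :=
    ContinuousLinearMap.ext fun u =>
      (hvx.isSymmSndFDerivAt minSmoothness_of_isRCLikeNormedField.le).eq u (v x)
  have hlocal : convectionField Ω v =ᶠ[𝓝 x]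
      fun y => fderiv ℝ v y (v y) - traceCLM E (fderiv ℝ v y) • v y := by
    filter_upwards [ho.mem_nhds hx] with y hy using convectionField_eq ho hy
  have hderiv := ((hD'.clm_apply hD).fun_sub
    (((traceCLM E).hasFDerivAt.comp x hD').fun_smul hD)).congr_of_eventuallyEq hlocal
  rw [hderiv.fderiv]
  simp only [map_sub, map_add, map_smul, traceCLM_smulRight, hsymm, Function.comp_apply,
    ContinuousLinearMap.comp_apply, smul_eq_mul]
  ring

end Trace

section Coordinates

variable {d : ℕ} {v : 𝔼 d → 𝔼 d} {x : 𝔼 d}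

theorem traceCLM_eq_sum (L : 𝔼 d →L[ℝ] 𝔼 d) :
    traceCLM (𝔼 d) L = ∑ i, L (EuclideanSpace.single i 1) i := by
  refine (LinearMap.trace_eq_sum_inner (L : 𝔼 d →ₗ[ℝ] 𝔼 d)
    (EuclideanSpace.basisFun (Fin d) ℝ)).trans ?_
  simp [EuclideanSpace.inner_single_left]

theorem partialD_eq (hv : DifferentiableAt ℝ v x) (i j : Fin d) :
    partialD v i j x = fderiv ℝ v x (EuclideanSpace.single j 1) i := by
  have hcoord : HasFDerivAt (fun y => v y i) (EuclideanSpace.proj i ∘L fderiv ℝ v x) x :=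
    (EuclideanSpace.proj (𝕜 := ℝ) i).hasFDerivAt.comp x hv.hasFDerivAt
  rw [partialD, hcoord.fderiv]
  rfl

theorem divergence_eq_traceCLM (hv : DifferentiableAt ℝ v x) :
    divergence v x = traceCLM (𝔼 d) (fderiv ℝ v x) := by
  rw [traceCLM_eq_sum]
  exact Finset.sum_congr rfl fun i _ => partialD_eq hv i i

theorem divergence_smul {a : 𝔼 d → ℝ} {w : 𝔼 d → 𝔼 d} (ha : DifferentiableAt ℝ a x)
    (hw : DifferentiableAt ℝ w x) :
    divergence (fun y => a y • w y) x = fderiv ℝ a x (w x) + a x * divergence w x := by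
  rw [divergence_eq_traceCLM (ha.fun_smul hw), divergence_eq_traceCLM hw, fderiv_fun_smul ha hw,
    map_add, map_smul, traceCLM_smulRight, smul_eq_mul, add_comm]

theorem apply_eq_sum_coord (L : 𝔼 d →L[ℝ] 𝔼 d) (u : 𝔼 d) (i : Fin d) :
    L u i = ∑ j, u j * L (EuclideanSpace.single j 1) i :=
  (sum_apply_single_mul (EuclideanSpace.proj i ∘L L) u).symm

/-- Twice the second principal invariant of the Jacobian matrix of `v`. -/
noncomputable def twiceSecondInvariant (v : 𝔼 d → 𝔼 d) (x : 𝔼 d) : ℝ :=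
  |divergence v x| ^ 2 - ∑ i, ∑ j, partialD v i j x * partialD v j i x

theorem divergence_convectionField {Ω : Set (𝔼 d)} (ho : IsOpen Ω) (hc : Convex ℝ Ω)
    (hv : ContDiffOn ℝ 2 v (closure Ω)) (hx : x ∈ Ω) :
    divergence (convectionField Ω v) x = -twiceSecondInvariant v x := by
  have hvx : DifferentiableAt ℝ v x :=
    (contDiffAt_of_contDiffOn_closure hv ho hx).differentiableAt two_ne_zero
  have hw : DifferentiableAt ℝ (convectionField Ω v) x := (contDiffAt_of_contDiffOn_closure
    (contDiffOn_convectionField ho hc hv) ho hx).differentiableAt one_ne_zero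
  have hcomp : traceCLM (𝔼 d) ((fderiv ℝ v x).comp (fderiv ℝ v x)) =
      ∑ i, ∑ j, partialD v i j x * partialD v j i x := by
    simp only [traceCLM_eq_sum, ContinuousLinearMap.comp_apply, partialD_eq hvx]
    refine Finset.sum_congr rfl fun i _ => (apply_eq_sum_coord _ _ i).trans ?_
    exact Finset.sum_congr rfl fun j _ => mul_comm _ _
  rw [divergence_eq_traceCLM hw, traceCLM_fderiv_convectionField ho hv hx, hcomp,
    ← divergence_eq_traceCLM hvx, twiceSecondInvariant, sq_abs, neg_sub]

theorem norm_apply_le_sqrt_sum_sq_mul_norm (L : 𝔼 d →L[ℝ] 𝔼 d) (u : 𝔼 d) :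
    ‖L u‖ ≤ √(∑ i, ∑ j, L (EuclideanSpace.single j 1) i ^ 2) * ‖u‖ := by
  have hnonneg : 0 ≤ ∑ i, ∑ j, L (EuclideanSpace.single j 1) i ^ 2 :=
    Finset.sum_nonneg fun i _ => Finset.sum_nonneg fun j _ => sq_nonneg _
  rw [EuclideanSpace.norm_eq (L u), EuclideanSpace.norm_eq u, ← Real.sqrt_mul hnonneg,
    Finset.sum_mul]
  refine Real.sqrt_le_sqrt (Finset.sum_le_sum fun i _ => ?_)
  simp only [Real.norm_eq_abs, sq_abs]
  rw [apply_eq_sum_coord L, mul_comm]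
  exact Finset.sum_mul_sq_le_sq_mul_sq _ _ _

theorem adjoint_apply_single (L : 𝔼 d →L[ℝ] 𝔼 d) (i j : Fin d) :
    ContinuousLinearMap.adjoint L (EuclideanSpace.single j 1) i =
      L (EuclideanSpace.single i 1) j := by
  simpa [EuclideanSpace.inner_single_left, EuclideanSpace.inner_single_right] using
    ContinuousLinearMap.adjoint_inner_right L (EuclideanSpace.single i 1)
      (EuclideanSpace.single j 1)

theorem norm_adjoint_fderiv_apply_sub_le (hv : DifferentiableAt ℝ v x) (u : 𝔼 d) :
    ‖ContinuousLinearMap.adjoint (fderiv ℝ v x) u - fderiv ℝ v x u‖ ≤ curlNorm v x * ‖u‖ := by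
  have hcurl : curlNorm v x = √(∑ i, ∑ j, (ContinuousLinearMap.adjoint (fderiv ℝ v x) -
      fderiv ℝ v x) (EuclideanSpace.single j 1) i ^ 2) := by
    rw [curlNorm, Finset.sum_comm]
    refine congrArg Real.sqrt (Finset.sum_congr rfl fun i _ => Finset.sum_congr rfl fun j _ => ?_)
    rw [sq_abs, partialD_eq hv, partialD_eq hv, sub_apply, PiLp.sub_apply, adjoint_apply_single]
  rw [hcurl, ← sub_apply]
  exact norm_apply_le_sqrt_sum_sq_mul_norm _ u

end Coordinates

theorem gradient_norm_sq {E F : Type*} [NormedAddCommGroup E] [InnerProductSpace ℝ E]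
    [CompleteSpace E] [NormedAddCommGroup F] [InnerProductSpace ℝ F] [CompleteSpace F]
    {v : E → F} {x : E} (hv : DifferentiableAt ℝ v x) :
    gradient (fun y => ‖v y‖ ^ 2) x =
      (2 : ℝ) • ContinuousLinearMap.adjoint (fderiv ℝ v x) (v x) := by
  refine ext_inner_right ℝ fun u => ?_
  rw [inner_gradient_left, hv.hasFDerivAt.norm_sq.fderiv,
    inner_smul_left, ContinuousLinearMap.adjoint_inner_left]
  simp

end Calculus

section Extension

variable {E F G : Type*} [NormedAddCommGroup E] [NormedAddCommGroup F] [NormedAddCommGroup G]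
  {Ω : Set E} {f f' : E → F} {φ : E → G}

/-- `f` agrees on `Ω` with a function that is continuous on the closure of `Ω`. The derivatives of
functions that are smooth up to the boundary have this property, whereas `fderiv` itself may take
the value `0` on the boundary. -/
def ExtendsContinuously (Ω : Set E) (f : E → F) : Prop :=
  ∃ f', ContinuousOn f' (closure Ω) ∧ EqOn f f' Ω

theorem extendsContinuously_of_continuousOn (hf : ContinuousOn f (closure Ω)) :
    ExtendsContinuously Ω f :=
  ⟨f, hf, eqOn_refl f Ω⟩

namespace ExtendsContinuously

theorem congr (hf : ExtendsContinuously Ω f) (h : EqOn f' f Ω) : ExtendsContinuously Ω f' :=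
  let ⟨f₀, hf₀, hff₀⟩ := hf
  ⟨f₀, hf₀, h.trans hff₀⟩

theorem comp {K : F → G} (hf : ExtendsContinuously Ω f) (hK : Continuous K) :
    ExtendsContinuously Ω fun x => K (f x) :=
  let ⟨f₀, hf₀, hff₀⟩ := hf
  ⟨K ∘ f₀, hK.comp_continuousOn hf₀, fun _ hx => congrArg K (hff₀ hx)⟩

theorem prodMk (hf : ExtendsContinuously Ω f) (hφ : ExtendsContinuously Ω φ) :
    ExtendsContinuously Ω fun x => (f x, φ x) :=
  let ⟨f₀, hf₀, hff₀⟩ := hf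
  let ⟨φ₀, hφ₀, hφφ₀⟩ := hφ
  ⟨fun x => (f₀ x, φ₀ x), hf₀.prodMk hφ₀, fun _ hx => Prod.ext (hff₀ hx) (hφφ₀ hx)⟩

theorem mul {a b : E → ℝ} (ha : ExtendsContinuously Ω a) (hb : ExtendsContinuously Ω b) :
    ExtendsContinuously Ω fun x => a x * b x :=
  (ha.prodMk hb).comp continuous_mul

theorem integrableOn [MeasurableSpace E] [OpensMeasurableSpace E] [ProperSpace E] {μ : Measure E}
    [IsFiniteMeasureOnCompacts μ] (hf : ExtendsContinuously Ω f) (ho : IsOpen Ω)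
    (hb : Bornology.IsBounded Ω) : IntegrableOn f Ω μ :=
  let ⟨_, hf₀, hff₀⟩ := hf
  ((hf₀.integrableOn_compact hb.isCompact_closure).mono_set subset_closure).congr_fun hff₀.symm
    ho.measurableSet

end ExtendsContinuously

theorem extendsContinuously_fderiv [NormedSpace ℝ E] [NormedSpace ℝ F] (ho : IsOpen Ω)
    (hc : Convex ℝ Ω) (hf : ContDiffOn ℝ 1 f (closure Ω)) : ExtendsContinuously Ω (fderiv ℝ f) :=
  ⟨fderivWithin ℝ f (closure Ω),
    hf.continuousOn_fderivWithin (uniqueDiffOn_closure_of_isOpen_of_convex ho hc) le_rfl,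
    fun _ hx => (fderivWithin_closure_eq ho hx).symm⟩

theorem extendsContinuously_norm_gradient {E : Type*} [NormedAddCommGroup E]
    [InnerProductSpace ℝ E] [CompleteSpace E] {Ω : Set E} {g : E → ℝ} (ho : IsOpen Ω)
    (hc : Convex ℝ Ω) (hg : ContDiffOn ℝ 1 g (closure Ω)) :
    ExtendsContinuously Ω fun x => ‖gradient g x‖ :=
  ((extendsContinuously_fderiv ho hc hg).comp
    (InnerProductSpace.toDual ℝ E).symm.continuous).comp continuous_norm

theorem exists_forall_norm_sq_mem_Icc [ProperSpace E] (hb : Bornology.IsBounded Ω)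
    (hf : ContinuousOn f (closure Ω)) : ∃ M, ∀ x ∈ Ω, ‖f x‖ ^ 2 ∈ Icc 0 M :=
  let ⟨M, hM⟩ := hb.isCompact_closure.bddAbove_image (hf.norm.pow 2)
  ⟨M, fun _ hx => ⟨sq_nonneg _, hM (mem_image_of_mem _ (subset_closure hx))⟩⟩

end Extension

section Jacobian

variable {d : ℕ} {Ω : Set (𝔼 d)} {v : 𝔼 d → 𝔼 d}

theorem extendsContinuously_partialD (ho : IsOpen Ω) (hc : Convex ℝ Ω)
    (hv : ContDiffOn ℝ 1 v (closure Ω)) :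
    ExtendsContinuously Ω fun x i j => partialD v i j x :=
  ((extendsContinuously_fderiv ho hc hv).comp
    (K := fun L i j => L (EuclideanSpace.single j 1) i) (by fun_prop)).congr fun _ hx =>
      funext₂ (partialD_eq
        ((contDiffAt_of_contDiffOn_closure hv ho hx).differentiableAt one_ne_zero))

theorem extendsContinuously_divergence (ho : IsOpen Ω) (hc : Convex ℝ Ω)
    (hv : ContDiffOn ℝ 1 v (closure Ω)) : ExtendsContinuously Ω (divergence v) :=
  (extendsContinuously_partialD ho hc hv).comp
    (K := fun P : Fin d → Fin d → ℝ => ∑ i, P i i) (by fun_prop)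

theorem extendsContinuously_twiceSecondInvariant (ho : IsOpen Ω) (hc : Convex ℝ Ω)
    (hv : ContDiffOn ℝ 1 v (closure Ω)) : ExtendsContinuously Ω (twiceSecondInvariant v) :=
  (extendsContinuously_partialD ho hc hv).comp
    (K := fun P : Fin d → Fin d → ℝ => |∑ i, P i i| ^ 2 - ∑ i, ∑ j, P i j * P j i) (by fun_prop)

theorem extendsContinuously_curlNorm_add_abs_divergence (ho : IsOpen Ω) (hc : Convex ℝ Ω)
    (hv : ContDiffOn ℝ 1 v (closure Ω)) :
    ExtendsContinuously Ω fun x => curlNorm v x + |divergence v x| :=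
  (extendsContinuously_partialD ho hc hv).comp
    (K := fun P : Fin d → Fin d → ℝ => √(∑ i, ∑ j, |P i j - P j i| ^ 2) + |∑ i, P i i|)
    (by fun_prop)

theorem curlNorm_add_abs_divergence_nonneg (v : 𝔼 d → 𝔼 d) :
    0 ≤ fun x => curlNorm v x + |divergence v x| :=
  fun _ => add_nonneg (Real.sqrt_nonneg _) (abs_nonneg _)

theorem measurable_partialD (v : 𝔼 d → 𝔼 d) (i j : Fin d) : Measurable (partialD v i j) :=
  measurable_fderiv_apply_const ℝ _ _

theorem measurable_curlNorm_add_abs_divergence (v : 𝔼 d → 𝔼 d) :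
    Measurable fun x => curlNorm v x + |divergence v x| := by
  have hP := measurable_partialD v
  unfold curlNorm divergence
  fun_prop

end Jacobian

section Estimate

variable {d : ℕ} {Ω : Set (𝔼 d)} {v : 𝔼 d → 𝔼 d} {x : 𝔼 d}

/-- Half the gradient of `‖v‖²` is `(Dv)ᵀ v`, which differs from `Dv v` by the antisymmetric part
of the Jacobian applied to `v`. -/
theorem sq_norm_gradient_sub_le (ho : IsOpen Ω) (hv : DifferentiableAt ℝ v x) (hx : x ∈ Ω) :
    ‖gradient (fun y => ‖v y‖ ^ 2) x‖ ^ 2 - 2 * (‖v x‖ *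
        ((curlNorm v x + |divergence v x|) * ‖gradient (fun y => ‖v y‖ ^ 2) x‖)) ≤
      2 * fderiv ℝ (fun y => ‖v y‖ ^ 2) x (convectionField Ω v x) := by
  set n := gradient (fun y => ‖v y‖ ^ 2) x with hn
  obtain ⟨z, hz⟩ : ∃ z, z = ContinuousLinearMap.adjoint (fderiv ℝ v x) (v x) -
    fderiv ℝ v x (v x) := ⟨_, rfl⟩
  have hw : (2 : ℝ) • convectionField Ω v x =
      n - (2 : ℝ) • z - (2 * divergence v x) • v x := by
    rw [convectionField_eq ho hx, hn, hz, gradient_norm_sq hv, divergence_eq_traceCLM hv]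
    module
  have hcurl : ⟪n, z⟫ ≤ ‖n‖ * (curlNorm v x * ‖v x‖) :=
    (real_inner_le_norm n z).trans (mul_le_mul_of_nonneg_left
      (hz ▸ norm_adjoint_fderiv_apply_sub_le hv (v x)) (norm_nonneg n))
  have hdiv : divergence v x * ⟪n, v x⟫ ≤ |divergence v x| * (‖n‖ * ‖v x‖) :=
    (le_abs_self _).trans ((abs_mul _ _).trans_le
      (mul_le_mul_of_nonneg_left (abs_real_inner_le_norm n (v x)) (abs_nonneg _)))
  calc ‖n‖ ^ 2 - 2 * (‖v x‖ * ((curlNorm v x + |divergence v x|) * ‖n‖))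
      ≤ ‖n‖ ^ 2 - 2 * ⟪n, z⟫ - 2 * (divergence v x * ⟪n, v x⟫) := by linarith
    _ = ⟪n, (2 : ℝ) • convectionField Ω v x⟫ := by
      rw [hw, inner_sub_right, inner_sub_right, real_inner_smul_right, real_inner_smul_right,
        real_inner_self_eq_norm_sq]
      ring
    _ = 2 * fderiv ℝ (fun y => ‖v y‖ ^ 2) x (convectionField Ω v x) := by
      rw [real_inner_smul_right, inner_gradient_left]

end Estimate

section WeakInequality

theorem hasDerivAt_primitive {ψ : ℝ → ℝ} (hψ : Continuous ψ) (r : ℝ) :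
    HasDerivAt (fun r => ∫ s in (0 : ℝ)..r, ψ s) (ψ r) r :=
  intervalIntegral.integral_hasDerivAt_right (hψ.intervalIntegrable _ _)
    (hψ.stronglyMeasurableAtFilter _ _) hψ.continuousAt

theorem contDiff_primitive {ψ : ℝ → ℝ} (hψ : Continuous ψ) :
    ContDiff ℝ 1 fun r => ∫ s in (0 : ℝ)..r, ψ s :=
  contDiff_one_iff_deriv.2 ⟨fun r => (hasDerivAt_primitive hψ r).differentiableAt,
    hψ.congr fun r => (hasDerivAt_primitive hψ r).deriv.symm⟩

variable {d : ℕ} {Ω : Set (𝔼 d)} {v : 𝔼 d → 𝔼 d} {a g : 𝔼 d → ℝ} {ψ : ℝ → ℝ} {x y : 𝔼 d}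

/-- The outward normal component of the convection field is minus the second fundamental form of
the boundary at `v`. -/
theorem apply_convectionField_nonpos_of_isSupportingAt (ho : IsOpen Ω) (hc : Convex ℝ Ω)
    (hC2 : HasC2Boundary Ω) (hv : ContDiffOn ℝ 2 v (closure Ω)) (hvt : IsTangentToFrontier Ω v)
    (hy : y ∈ frontier Ω) {ℓ : 𝔼 d →L[ℝ] ℝ} (hℓ : IsSupportingAt Ω y ℓ) :
    ℓ (convectionField Ω v y) ≤ 0 := by
  obtain ⟨U, ρ, hρ⟩ := hC2 y hy
  refine hρ.apply_nonpos_of_isSupportingAt ho hy hℓ ?_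
  rw [convectionField, map_sub, map_smul, hρ.fderiv_apply_eq_zero hy hvt, smul_zero, sub_zero]
  exact hρ.fderiv_apply_apply_nonpos ho hc hy hvt
    (hv.differentiableOn two_ne_zero y (frontier_subset_closure hy)).hasFDerivWithinAt

theorem setIntegral_divergence_smul_convectionField_nonpos [Nontrivial (𝔼 d)] (ho : IsOpen Ω)
    (hb : Bornology.IsBounded Ω) (hc : Convex ℝ Ω) (hC2 : HasC2Boundary Ω)
    (hv : ContDiffOn ℝ 2 v (closure Ω)) (hvt : IsTangentToFrontier Ω v)
    (ha : ContDiffOn ℝ 1 a (closure Ω)) (ha0 : 0 ≤ a) :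
    ∫ x in Ω, divergence (fun x => a x • convectionField Ω v x) x ≤ 0 := by
  have hX : ContDiffOn ℝ 1 (fun x => a x • convectionField Ω v x) (closure Ω) :=
    ha.smul (contDiffOn_convectionField ho hc hv)
  obtain ⟨C, hC⟩ := hX.exists_lipschitzOnWith one_ne_zero hc.closure hb.isCompact_closure
  refine setIntegral_divergence_nonpos ho hb hc hC
    ((extendsContinuously_divergence ho hc hX).integrableOn ho hb) fun y hy ℓ hℓ => ?_
  rw [map_smul, smul_eq_mul]
  exact mul_nonpos_of_nonneg_of_nonpos (ha0 y)
    (apply_convectionField_nonpos_of_isSupportingAt ho hc hC2 hv hvt hy hℓ)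

theorem divergence_primitive_comp_smul_convectionField (ho : IsOpen Ω) (hc : Convex ℝ Ω)
    (hv : ContDiffOn ℝ 2 v (closure Ω)) (hg : DifferentiableAt ℝ g x) (hψ : Continuous ψ)
    (hx : x ∈ Ω) :
    divergence (fun x => (∫ s in (0 : ℝ)..g x, ψ s) • convectionField Ω v x) x =
      ψ (g x) * fderiv ℝ g x (convectionField Ω v x) -
        (∫ s in (0 : ℝ)..g x, ψ s) * twiceSecondInvariant v x := by
  have hΦ : HasFDerivAt (fun x => ∫ s in (0 : ℝ)..g x, ψ s) (ψ (g x) • fderiv ℝ g x) x :=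
    (hasDerivAt_primitive hψ (g x)).comp_hasFDerivAt x hg.hasFDerivAt
  have hw : DifferentiableAt ℝ (convectionField Ω v) x := (contDiffAt_of_contDiffOn_closure
    (contDiffOn_convectionField ho hc hv) ho hx).differentiableAt one_ne_zero
  rw [divergence_smul hΦ.differentiableAt hw, hΦ.fderiv, divergence_convectionField ho hc hv hx,
    smul_apply, smul_eq_mul, mul_neg, sub_eq_add_neg]

theorem mul_sq_norm_gradient_le (ho : IsOpen Ω) (hc : Convex ℝ Ω)
    (hv : ContDiffOn ℝ 2 v (closure Ω)) (hψ : Continuous ψ) (hψ0 : 0 ≤ ψ) (hx : x ∈ Ω) :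
    ψ (‖v x‖ ^ 2) *
        (‖gradient (fun y => ‖v y‖ ^ 2) x‖ * ‖gradient (fun y => ‖v y‖ ^ 2) x‖) ≤
      ψ (‖v x‖ ^ 2) * (2 * √(‖v x‖ ^ 2)) *
          ((curlNorm v x + |divergence v x|) * ‖gradient (fun y => ‖v y‖ ^ 2) x‖) +
        2 * twiceSecondInvariant v x * (∫ s in (0 : ℝ)..‖v x‖ ^ 2, ψ s) +
        2 * divergence (fun x => (∫ s in (0 : ℝ)..‖v x‖ ^ 2, ψ s) • convectionField Ω v x) x := by
  have hvx : DifferentiableAt ℝ v x :=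
    (contDiffAt_of_contDiffOn_closure hv ho hx).differentiableAt two_ne_zero
  rw [divergence_primitive_comp_smul_convectionField ho hc hv (hvx.norm_sq ℝ) hψ hx,
    Real.sqrt_sq (norm_nonneg _)]
  linarith [mul_le_mul_of_nonneg_left (sq_norm_gradient_sub_le ho hvx hx) (hψ0 (‖v x‖ ^ 2))]

theorem setIntegral_mul_sq_norm_gradient_le [Nontrivial (𝔼 d)] (ho : IsOpen Ω)
    (hb : Bornology.IsBounded Ω) (hc : Convex ℝ Ω) (hC2 : HasC2Boundary Ω)
    (hv : ContDiffOn ℝ 2 v (closure Ω)) (hvt : IsTangentToFrontier Ω v)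
    (hψ : Continuous ψ) (hψ0 : 0 ≤ ψ) :
    ∫ x in Ω, ψ (‖v x‖ ^ 2) *
        (‖gradient (fun y => ‖v y‖ ^ 2) x‖ * ‖gradient (fun y => ‖v y‖ ^ 2) x‖) ≤
      (∫ x in Ω, ψ (‖v x‖ ^ 2) * (2 * √(‖v x‖ ^ 2)) *
        ((curlNorm v x + |divergence v x|) * ‖gradient (fun y => ‖v y‖ ^ 2) x‖)) +
      ∫ x in Ω, 2 * twiceSecondInvariant v x * ∫ s in (0 : ℝ)..‖v x‖ ^ 2, ψ s := by
  have hv1 : ContDiffOn ℝ 1 v (closure Ω) := hv.of_le one_le_two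
  have hg1 : ContDiffOn ℝ 1 (fun x => ‖v x‖ ^ 2) (closure Ω) := hv1.norm_sq ℝ
  have hΦ : ContDiffOn ℝ 1 (fun x => ∫ s in (0 : ℝ)..‖v x‖ ^ 2, ψ s) (closure Ω) :=
    (contDiff_primitive hψ).comp_contDiffOn hg1
  have hgrad := extendsContinuously_norm_gradient ho hc hg1
  have hg := extendsContinuously_of_continuousOn hg1.continuousOn
  have hψg := hg.comp hψ
  have hcurl := ((hg.comp (K := fun r => ψ r * (2 * √r)) (by fun_prop)).mul
    ((extendsContinuously_curlNorm_add_abs_divergence ho hc hv1).mul hgrad)).integrableOn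
      (μ := volume) ho hb
  have hinv := (((extendsContinuously_twiceSecondInvariant ho hc hv1).comp
    (continuous_const_mul 2)).mul
    (extendsContinuously_of_continuousOn hΦ.continuousOn)).integrableOn (μ := volume) ho hb
  have hdiv := (extendsContinuously_divergence ho hc
    (hΦ.fun_smul (contDiffOn_convectionField ho hc hv))).integrableOn (μ := volume) ho hb
  have hmono := setIntegral_mono_on ((hψg.mul (hgrad.mul hgrad)).integrableOn ho hb)
    ((hcurl.fun_add hinv).fun_add (hdiv.const_mul 2)) ho.measurableSet
    fun x hx => mul_sq_norm_gradient_le ho hc hv hψ hψ0 hx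
  have hflux := setIntegral_divergence_smul_convectionField_nonpos ho hb hc hC2 hv hvt hΦ
    fun x => intervalIntegral.integral_nonneg (sq_nonneg ‖v x‖) fun s _ => hψ0 s
  rw [integral_add (hcurl.fun_add hinv) (hdiv.const_mul 2), integral_add hcurl hinv,
    integral_const_mul] at hmono
  linarith

end WeakInequality

end

theorem lemma2p1 (d : ℕ) (hd : 2 ≤ d)
    (Ω : Set (EuclideanSpace ℝ (Fin d)))
    (hΩ_open : IsOpen Ω) (hΩ_bdd : Bornology.IsBounded Ω) (hΩ_convex : Convex ℝ Ω)
    (hΩ_C2 : HasC2Boundary Ω)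
    (v : EuclideanSpace ℝ (Fin d) → EuclideanSpace ℝ (Fin d))
    (hv : ContDiffOn ℝ 2 v (closure Ω))
    (hvn : ∀ p ∈ frontier Ω, ∀ n, IsUnitOutwardNormal Ω p n → inner ℝ (v p) n = 0)
    (g : EuclideanSpace ℝ (Fin d) → ℝ) (hg : ∀ x, g x = ‖v x‖ ^ 2) :
    ∀ᵐ t : ℝ, 0 < t →
      MeasureTheory.IntegrableOn (fun x => ‖gradient g x‖) {x ∈ Ω | g x = t} μHE[d - 1] ∧
      MeasureTheory.IntegrableOn (fun x => curlNorm v x + |divergence v x|)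
        {x ∈ Ω | g x = t} μHE[d - 1] ∧
      MeasureTheory.IntegrableOn
        (fun x => |divergence v x| ^ 2 - ∑ i, ∑ j, partialD v i j x * partialD v j i x)
        {x ∈ Ω | t < g x} ∧
      ∫ x in {x ∈ Ω | g x = t}, ‖gradient g x‖ ∂μHE[d - 1] ≤
        2 * √t * ∫ x in {x ∈ Ω | g x = t}, (curlNorm v x + |divergence v x|) ∂μHE[d - 1]
        + 2 * ∫ x in {x ∈ Ω | t < g x},
            (|divergence v x| ^ 2 - ∑ i, ∑ j, partialD v i j x * partialD v j i x) := by
  obtain rfl : g = fun x => ‖v x‖ ^ 2 := funext hg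
  have : Nontrivial (Fin d) := Fin.nontrivial_iff_two_le.2 hd
  have hv1 : ContDiffOn ℝ 1 v (closure Ω) := hv.of_le one_le_two
  have hg1 : ContDiffOn ℝ 1 (fun x => ‖v x‖ ^ 2) (closure Ω) := hv1.norm_sq ℝ
  have hgΩ := hg1.mono subset_closure
  obtain ⟨M, hM⟩ := exists_forall_norm_sq_mem_Icc hΩ_bdd hv.continuousOn
  have hgrad_meas := (measurable_gradient fun x => ‖v x‖ ^ 2).norm
  have hcurl_meas := measurable_curlNorm_add_abs_divergence v
  have hcurl_nonneg := curlNorm_add_abs_divergence_nonneg v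
  have hgrad := extendsContinuously_norm_gradient hΩ_open hΩ_convex hg1
  have hcurl := extendsContinuously_curlNorm_add_abs_divergence hΩ_open hΩ_convex hv1
  have hinv := extendsContinuously_twiceSecondInvariant hΩ_open hΩ_convex hv1
  have hgrad_int := (hgrad.mul hgrad).integrableOn (μ := MeasureTheory.volume) hΩ_open hΩ_bdd
  have hcurl_int := (hcurl.mul hgrad).integrableOn (μ := MeasureTheory.volume) hΩ_open hΩ_bdd
  have hinv_int := hinv.integrableOn (μ := MeasureTheory.volume) hΩ_open hΩ_bdd
  have hle := ae_levelIntegral_le hΩ_open hΩ_bdd hgΩ hM hgrad_meas (fun _ => norm_nonneg _)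
    hgrad_int hcurl_meas hcurl_nonneg hcurl_int (hinv_int.const_mul 2) (c := fun t => 2 * √t)
    (by fun_prop) (fun _ => by positivity)
    fun _ => setIntegral_mul_sq_norm_gradient_le hΩ_open hΩ_bdd hΩ_convex hΩ_C2 hv hvn
  have hgrad_level := ae_integrableOn_level hΩ_open hΩ_bdd hgΩ hgrad_meas
    (fun _ => norm_nonneg _) hgrad_int
  have hcurl_level := ae_integrableOn_level hΩ_open hΩ_bdd hgΩ hcurl_meas hcurl_nonneg hcurl_int
  simp only [levelIntegral, finrank_euclideanSpace_fin, MeasureTheory.integral_const_mul]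
    at hle hgrad_level hcurl_level
  filter_upwards [hle, hgrad_level, hcurl_level] with t ht hgrad_t hcurl_t htpos
  exact ⟨hgrad_t, hcurl_t, hinv_int.mono_set (Set.sep_subset _ _), ht htpos⟩
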